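/- Let $K$ be a non-empty compact metric space, and let $V$ be a non-negative sample-continuous process on $K$ with $\mathbb{E}\,V(x)=1$ for all $x\in K$. Let $Z$ be a sample-continuous (simple max-stable) process on $K$ with spectral process $V$, i.e. $\{Z(x)\}_{x\in K}=\{\max_{j\ge 1}\Gamma_j^{-1}V_j(x)\}_{x\in K}$ in distribution, where $\Gamma_1<\Gamma_2<\dots$ are the arrival times of a unit rate Poisson process on $(0,\infty)$ and $V_1,V_2,\dots$ are i.i.d. copies of $V$ independent of $(\Gamma_j)_j$. For $\tau>0$ and a non-negative sample-continuous process $W$ on $K$, threshold stopping with spectral process $W$ and threshold $\tau$ has the stopping time $$T=\min\Big\{j\ge 1:\ \Gamma_{j+1}^{-1}\tau<\inf_{x\in K}\max_{1\le i\le j}\Gamma_i^{-1}W_i(x)\Big\},$$ where the $\Gamma_j$ are the arrival times of a unit rate Poisson process, independent of the i.i.d. copies $W_1,W_2,\dots$ of $W$. It is the number of simulated spectral processes. (a) Put $\theta_\infty=\mathbb{E}\{\sup_{x\in K}V(x)\}$ (it is finite because $Z$ is sample-continuous). Let $W=V^{\|\cdot\|_\infty}$ be the sup-normalized spectral process, that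 is, $W=\theta_\infty\,Y/\sup_{x\in K}Y(x)$ in law, where $\mathbb{P}\{Y\in A\}=\theta_\infty^{-1}\int_A\sup_{x\in K}v(x)\,\mathbb{P}\{V\in dv\}$ for Borel sets $A\subset C(K)$. Then threshold stopping with spectral process $W$ and threshold $\tau=\theta_\infty$ satisfies $$\mathbb{E}\,T=\theta_\infty\,\mathbb{E}\Big\{1\Big/\inf_{x\in K}Z(x)\Big\}.$$ (b) Suppose that $K=\{x_1,\dots,x_N\}$ is finite. Let $W=V^{\|\cdot\|_1}$ be the sum-normalized spectral process, that is, $W=N\,Y/\sum_{k=1}^N Y(x_k)$ in law, where $Y\sim\frac1N\sum_{k=1}^N P_k$ and $P_k(A)=\int v(x_k)\,\mathbf 1\{v\in v(x_k)A\}\,\mathbb{P}\{V\in dv\}$. Then threshold stopping with spectral process $W$ and threshold $\tau=N$ satisfies $$\mathbb{E}\,T=N\,\mathbb{E}\Big\{1\Big/\inf_{x\in K}Z(x)\Big\}.$$ Both identities are between elements of $[0,\infty]$. -/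

import Mathlib

open MeasureTheory ProbabilityTheory
open scoped NNReal ENNReal

namespace MaxStable

noncomputable section

/-- The path space `C(K, [0, ∞))` of a non-negative sample-continuous process carries the Borel
sigma-algebra of the topology of uniform convergence. -/
instance instMeasurableSpacePath {K : Type*} [TopologicalSpace K] :
    MeasurableSpace C(K, ℝ≥0) := borel _

instance instBorelSpacePath {K : Type*} [TopologicalSpace K] : BorelSpace C(K, ℝ≥0) := ⟨rfl⟩

/-- The law `μ` of a non-negative sample-continuous process `V` on `K` with `E V(x) = 1` for
every `x`. -/
structure IsSpectralLaw {K : Type*} [TopologicalSpace K] (μ : Measure C(K, ℝ≥0)) : Prop where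
  isProbabilityMeasure : IsProbabilityMeasure μ
  lintegral_eval : ∀ x : K, ∫⁻ v, (v x : ℝ≥0∞) ∂μ = 1

/-- The arrival time `Γ_j = e_0 + ⋯ + e_{j-1}` of a renewal process with interarrival times
`e`. -/
def arrivalTime (e : ℕ → ℝ) (j : ℕ) : ℝ := ∑ i ∈ Finset.range j, e i

/-- The contribution `Γ_{i+1}⁻¹ w_i(x)` of the `(i+1)`-st point of the process. -/
def contribution {K : Type*} [TopologicalSpace K] (e : ℕ → ℝ) (w : ℕ → C(K, ℝ≥0)) (i : ℕ)
    (x : K) : ℝ≥0∞ :=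
  (w i x : ℝ≥0∞) / ENNReal.ofReal (arrivalTime e (i + 1))

/-- `Z^{(j)}(x)`, the maximum of the contributions of the first `j` points. -/
def partialMax {K : Type*} [TopologicalSpace K] (e : ℕ → ℝ) (w : ℕ → C(K, ℝ≥0)) (j : ℕ)
    (x : K) : ℝ≥0∞ :=
  ⨆ i ∈ Finset.range j, contribution e w i x

/-- The maximum of the contributions of all points. -/
def fullMax {K : Type*} [TopologicalSpace K] (e : ℕ → ℝ) (w : ℕ → C(K, ℝ≥0)) (x : K) : ℝ≥0∞ :=
  ⨆ i : ℕ, contribution e w i x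

/-- The stopping time `T_τ = min {j ≥ 1 : Γ_{j+1}⁻¹ τ < inf_{x ∈ K} Z^{(j)}(x)}` of threshold
stopping with threshold `τ` (it is `⊤` if there is no such `j`). -/
def stoppingTime {K : Type*} [TopologicalSpace K] (τ : ℝ≥0∞) (e : ℕ → ℝ)
    (w : ℕ → C(K, ℝ≥0)) : ℕ∞ :=
  ⨅ (j : ℕ) (_ : 1 ≤ j ∧
    τ / ENNReal.ofReal (arrivalTime e (j + 1)) < ⨅ x : K, partialMax e w j x), (j : ℕ∞)

/-- `E` are the interarrival times and `W` the marks of an independently marked unit rate Poisson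
process on `(0, ∞)` with mark distribution `μ`: the `E j` are standard exponential, the `W j` have
law `μ`, and all these random variables are independent. -/
structure IsMarkedPoisson {K : Type*} [TopologicalSpace K] {Ω : Type*} [MeasurableSpace Ω]
    (P : Measure Ω) (μ : Measure C(K, ℝ≥0)) (E : ℕ → Ω → ℝ) (W : ℕ → Ω → C(K, ℝ≥0)) :
    Prop where
  hasLaw : ∀ j, HasLaw (fun ω => (E j ω, W j ω)) ((expMeasure 1).prod μ) P
  iIndepFun : iIndepFun (fun j ω => (E j ω, W j ω)) P

/-- The supremum norm of a non-negative function. -/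
def supNorm {K : Type*} [TopologicalSpace K] (v : C(K, ℝ≥0)) : ℝ≥0 := ⨆ x : K, v x

/-- The constant `θ_∞ = E (sup_{x ∈ K} V(x))` for `V` of law `μ`. -/
def supCoeff {K : Type*} [TopologicalSpace K] (μ : Measure C(K, ℝ≥0)) : ℝ≥0∞ :=
  ∫⁻ v, (supNorm v : ℝ≥0∞) ∂μ

/-- The transformed law `A ↦ θ_∞⁻¹ ∫_A sup_{x ∈ K} v(x) μ(dv)`. -/
def supTiltedLaw {K : Type*} [TopologicalSpace K] (μ : Measure C(K, ℝ≥0)) :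
    Measure C(K, ℝ≥0) :=
  (supCoeff μ)⁻¹ • μ.withDensity (fun v => (supNorm v : ℝ≥0∞))

/-- The law of the sup-normalized spectral process `θ_∞ Y / sup_{x ∈ K} Y(x)`, where `Y` has the
transformed law. -/
def supNormalizedLaw {K : Type*} [TopologicalSpace K] (μ : Measure C(K, ℝ≥0)) :
    Measure C(K, ℝ≥0) :=
  (supTiltedLaw μ).map (fun y => ((supCoeff μ).toNNReal / supNorm y) • y)

/-- The law `A ↦ ∫ v(a) 1{v ∈ v(a) A} μ(dv)` of the spectral process that equals `1` at the
point `a`. -/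
def pointNormalizedLaw {K : Type*} [TopologicalSpace K] (μ : Measure C(K, ℝ≥0)) (a : K) :
    Measure C(K, ℝ≥0) :=
  (μ.withDensity (fun v => (v a : ℝ≥0∞))).map (fun v => (v a)⁻¹ • v)

/-- The law of the sum-normalized spectral process `N Y / ∑ₖ Y(x_k)`, where `Y` is distributed
according to the equal mixture of the laws normalized at `x_1, …, x_N`. -/
def sumNormalizedLaw {K : Type*} [TopologicalSpace K] (μ : Measure C(K, ℝ≥0)) {N : ℕ}
    (x : Fin N → K) : Measure C(K, ℝ≥0) :=
  ((N : ℝ≥0∞)⁻¹ • ∑ k, pointNormalizedLaw μ (x k)).map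
    (fun y => ((N : ℝ≥0) / ∑ k, y (x k)) • y)

end

end MaxStable

namespace MaxStable

open Set Filter Topology

/-! Write Z^(j) for the maximum over the first j simulated points. As j grows, inf Z^(j) increases
and τ/Γ_{j+1} decreases, so T is the number of j ≥ 0 with Γ_{j+1} ≤ τ / inf Z^(j), that is, with E_j
≤ a_j for the residual a_j = (τ / inf Z^(j) - Γ_j)^+. This residual depends on the first j points
only, whereas E_j is independent of them and exponential. Since P(X ≤ a) = E min(a, X) for an
exponential X, each indicator may be replaced in mean by min(a_j, E_j)
(`lintegral_interarrival_le`).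

The new sum can be evaluated path by path. The marks are bounded by τ, so points after the n-th
cannot raise the maximum above τ/Γ_{n+1}; hence the partial sums are min(τ / inf Z^W, Γ_n), where
Z^W is the maximum over all points, and the total is τ / inf Z^W (`tsum_min_eq`). Therefore E T = τ
E(1 / inf Z^W).

It remains to see that Z^W and Z have the same law on a countable dense set. Their distribution
functions are void probabilities exp(-E sup W/z) of a marked Poisson process (`pointLaw_void`,
`pointLaw_maxAt_le`), and both normalizations preserve the mean of every measurable functional that
is homogeneous of degree one (`lintegral_supNormalizedLaw`, `lintegral_sumNormalizedLaw`). The same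
formula shows that θ_∞ is finite. -/

instance instIsProbabilityMeasureExp : IsProbabilityMeasure (expMeasure 1) :=
  isProbabilityMeasure_expMeasure one_pos

/-! ### The standard exponential distribution. -/

/-- Integration against the standard exponential distribution. -/
lemma lintegral_expMeasure {f : ℝ → ℝ≥0∞} (hf : Measurable f) :
    ∫⁻ x, f x ∂expMeasure 1 = ∫⁻ x in Ioi 0, ENNReal.ofReal (Real.exp (-x)) * f x := by
  have h : expMeasure 1 = volume.withDensity (exponentialPDF 1) := rfl
  have hd : Measurable (exponentialPDF 1) := (measurable_exponentialPDFReal 1).ennreal_ofReal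
  rw [h, lintegral_withDensity_eq_lintegral_mul _ hd hf,
    setLIntegral_congr (Ioi_ae_eq_Ici (a := (0 : ℝ))), ← lintegral_indicator measurableSet_Ici]
  congr 1 with x
  by_cases hx : 0 ≤ x
  · simp [hx, exponentialPDF_of_nonneg]
  · simp [hx, exponentialPDF_of_neg (not_le.1 hx)]

lemma expMeasure_apply {s : Set ℝ} (hs : MeasurableSet s) :
    expMeasure 1 s
      = ∫⁻ x in Ioi 0, ENNReal.ofReal (Real.exp (-x)) * s.indicator 1 x := by
  rw [← lintegral_expMeasure (measurable_one.indicator hs), lintegral_indicator_one hs]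

lemma ae_pos_expMeasure : ∀ᵐ x ∂expMeasure 1, 0 < x := by
  have h := expMeasure_apply (measurableSet_Iic (a := (0 : ℝ)))
  rw [setLIntegral_congr_fun (g := fun _ => 0) measurableSet_Ioi] at h
  · rw [ae_iff]
    simpa [Iic_def] using h
  · intro x hx
    simp [not_le.2 (mem_Ioi.1 hx)]

lemma expMeasure_Ioi {t : ℝ} (ht : 0 ≤ t) :
    expMeasure 1 (Ioi t) = ENNReal.ofReal (Real.exp (-t)) := by
  have h := ofReal_cdf (expMeasure 1) t
  rw [cdf_expMeasure_eq one_pos, if_pos ht] at h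
  rw [← compl_Iic, prob_compl_eq_one_sub measurableSet_Iic, ← h, ← ENNReal.ofReal_one,
    ← ENNReal.ofReal_sub _ (by simp [ht])]
  simp

/-- For a standard exponential random variable `X`, the mean of `min a X` is `ℙ (X ≤ a)`. -/
lemma lintegral_min_expMeasure (a : ℝ≥0∞) :
    ∫⁻ x, min a (ENNReal.ofReal x) ∂expMeasure 1
      = expMeasure 1 {x | ENNReal.ofReal x ≤ a} := by
  have hm : Measurable fun x : ℝ => (min a (ENNReal.ofReal x)).toReal := by fun_prop
  have hfin : ∀ x : ℝ, min a (ENNReal.ofReal x) ≠ ∞ := fun x =>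
    ne_top_of_le_ne_top ENNReal.ofReal_ne_top (min_le_right _ _)
  -- Layer cake: `min a X` has tail 1{t < a} e^{-t}. The exponential density equals its own tail, so
  -- integrating this gives P(X < a); there is no atom at `a`.
  have h := lintegral_eq_lintegral_meas_lt (expMeasure 1)
    (f := fun x => (min a (ENNReal.ofReal x)).toReal) (ae_of_all _ fun x => by positivity)
    hm.aemeasurable
  simp only [ENNReal.ofReal_toReal (hfin _)] at h
  have hlt : MeasurableSet {x : ℝ | ENNReal.ofReal x < a} :=
    measurableSet_lt (by fun_prop) measurable_const
  have hae : expMeasure 1 {x | ENNReal.ofReal x ≤ a} = expMeasure 1 {x | ENNReal.ofReal x < a} := by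
    refine measure_congr ?_
    have h0 : ∀ᵐ x ∂expMeasure 1, x ≠ a.toReal :=
      (withDensity_absolutelyContinuous volume (exponentialPDF 1)).ae_le
        (Measure.ae_ne volume _)
    filter_upwards [h0, ae_pos_expMeasure] with x hx hx0
    refine propext ⟨fun hle => lt_of_le_of_ne hle fun he => hx ?_, fun hl => le_of_lt hl⟩
    rw [← he, ENNReal.toReal_ofReal hx0.le]
  rw [h, hae, expMeasure_apply hlt]
  refine setLIntegral_congr_fun measurableSet_Ioi fun t ht => ?_
  have ht0 : 0 < t := ht
  have hset : {x : ℝ | t < (min a (ENNReal.ofReal x)).toReal}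
      = {x : ℝ | ENNReal.ofReal t < a ∧ t < x} := by
    ext x
    rw [mem_ofPred_eq, ← ENNReal.ofReal_lt_iff_lt_toReal ht0.le (hfin x), lt_min_iff]
    refine and_congr_right fun _ => ⟨fun h => (ENNReal.ofReal_lt_ofReal_iff'.1 h).1,
      fun h => ENNReal.ofReal_lt_ofReal_iff'.2 ⟨h, ht0.trans h⟩⟩
  simp only [hset]
  by_cases hta : ENNReal.ofReal t < a
  · simpa [hta, Ioi_def] using expMeasure_Ioi ht0.le
  · simp [hta]

/-! ### The i.i.d. sequence of interarrival times and marks. -/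

/-- The law of the sequence of points of a marked unit rate Poisson process. -/
noncomputable def pointLaw {S : Type*} [MeasurableSpace S] (ν : Measure S) :
    Measure (ℕ → ℝ × S) :=
  Measure.infinitePi fun _ => (expMeasure 1).prod ν

section PointLaw

variable {S : Type*} [MeasurableSpace S] (ν : Measure S) [IsProbabilityMeasure ν]

instance : IsProbabilityMeasure (pointLaw ν) := by
  unfold pointLaw; infer_instance

lemma ae_pointLaw_of_ae {p : ℝ × S → Prop} (hp : ∀ᵐ y ∂(expMeasure 1).prod ν, p y) :
    ∀ᵐ s ∂pointLaw ν, ∀ j, p (s j) := by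
  rw [ae_all_iff]
  intro j
  have h := (measurePreserving_eval_infinitePi (fun _ : ℕ => (expMeasure 1).prod ν) j)
  exact h.quasiMeasurePreserving.ae hp

lemma ae_pointLaw_pos : ∀ᵐ s ∂pointLaw ν, ∀ j, 0 < (s j).1 :=
  ae_pointLaw_of_ae ν (Measure.quasiMeasurePreserving_fst.ae ae_pos_expMeasure)

lemma ae_pointLaw_mark {p : S → Prop} (hp : ∀ᵐ w ∂ν, p w) :
    ∀ᵐ s ∂pointLaw ν, ∀ j, p (s j).2 :=
  ae_pointLaw_of_ae ν (Measure.quasiMeasurePreserving_snd.ae hp)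

/-- By independence the probability is at most c^n for every n, with c = P(X ≤ M) < 1. Unbounded
positive interarrival times already force the arrival times to infinity, so no law of large numbers
is needed. -/
lemma measure_forall_le_eq_zero (M : ℝ) : pointLaw ν {s | ∀ j, (s j).1 ≤ M} = 0 := by
  set c := expMeasure 1 (Iic M) with hc
  have hc1 : c < 1 := by
    have h : 0 < expMeasure 1 (Ioi (max M 0)) := by
      rw [expMeasure_Ioi (le_max_right _ _)]; simp [Real.exp_pos]
    refine lt_of_le_of_ne prob_le_one fun h1 => h.ne' ?_
    refine measure_mono_null (t := (Iic M)ᶜ) (fun x hx => ?_) ?_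
    · simpa using (lt_of_le_of_lt (le_max_left _ _) hx)
    · rw [prob_compl_eq_zero_iff measurableSet_Iic]; exact h1
  have hle : ∀ n : ℕ, pointLaw ν {s | ∀ j, (s j).1 ≤ M} ≤ c ^ n := by
    intro n
    have h := Measure.infinitePi_pi (fun _ : ℕ => (expMeasure 1).prod ν)
      (s := Finset.range n) (t := fun _ => Iic M ×ˢ univ)
      (fun _ _ => measurableSet_Iic.prod MeasurableSet.univ)
    simp only [Measure.prod_prod, measure_univ, mul_one, Finset.prod_const,
      Finset.card_range] at h
    rw [hc, ← h]
    exact measure_mono fun s hs j _ => ⟨hs j, trivial⟩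
  exact le_antisymm (ge_of_tendsto' (ENNReal.tendsto_pow_atTop_nhds_zero_of_lt_one hc1) hle)
    zero_le

/-- The arrival times tend to infinity almost surely. -/
lemma ae_tendsto_arrivalTime :
    ∀ᵐ s ∂pointLaw ν, Tendsto (arrivalTime fun j => (s j).1) atTop atTop := by
  have h : ∀ᵐ s ∂pointLaw ν, ∀ M : ℕ, ¬ ∀ j, (s j).1 ≤ (M : ℝ) :=
    ae_all_iff.2 fun M => by
      rw [ae_iff]; simpa using measure_forall_le_eq_zero ν M
  filter_upwards [h, ae_pointLaw_pos ν] with s hs hpos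
  have hmono : Monotone (arrivalTime fun j => (s j).1) :=
    monotone_nat_of_le_succ fun n => by
      simp [arrivalTime, Finset.sum_range_succ, (hpos n).le]
  refine tendsto_atTop_atTop_of_monotone hmono fun b => ?_
  obtain ⟨M, hM⟩ := exists_nat_ge b
  obtain ⟨j, hj⟩ := not_forall.1 (hs M)
  refine ⟨j + 1, hM.trans ((not_le.1 hj).le.trans ?_)⟩
  rw [arrivalTime]
  exact Finset.single_le_sum (f := fun j => (s j).1) (fun i _ => (hpos i).le) (by simp)

/-- A point is independent of the points that precede it. -/
lemma lintegral_pointLaw_step (n : ℕ) {Φ : (ℕ → ℝ × S) → ℝ × S → ℝ≥0∞}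
    (hΦ : Measurable (Function.uncurry Φ))
    (hdep : ∀ s s' y, (∀ i < n, s i = s' i) → Φ s y = Φ s' y) :
    ∫⁻ s, Φ s (s n) ∂pointLaw ν
      = ∫⁻ s, ∫⁻ y, Φ s y ∂(expMeasure 1).prod ν ∂pointLaw ν := by
  classical
  obtain ⟨y₀⟩ : Nonempty (ℝ × S) := (expMeasure 1 |>.prod ν).nonempty_of_neZero
  -- Padding the first `n` points with the fixed `y₀` exhibits `Φ` as a function of finitely many
  -- coordinates, which are independent of the `n`-th one.
  let ext : (Finset.range n → ℝ × S) → ℕ → ℝ × S :=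
    fun p i => if h : i ∈ Finset.range n then p ⟨i, h⟩ else y₀
  have hext : Measurable ext := by
    refine measurable_pi_lambda _ fun i => ?_
    by_cases h : i ∈ Finset.range n
    · simp only [ext, dif_pos h]
      exact measurable_pi_apply _
    · simp only [ext, dif_neg h]
      exact measurable_const
  let past : (ℕ → ℝ × S) → ℕ → ℝ × S := fun s => ext fun i => s i
  have hres : Measurable fun (s : ℕ → ℝ × S) (i : Finset.range n) => s i :=
    measurable_pi_lambda _ fun i => measurable_pi_apply (i : ℕ)
  have hpast : Measurable past := hext.comp hres
  have hpe : ∀ s y, Φ s y = Φ (past s) y := fun s y => hdep _ _ _ fun i hi => by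
    simp [past, ext, hi]
  have hind : iIndepFun (fun (i : ℕ) (s : ℕ → ℝ × S) => s i) (pointLaw ν) :=
    iIndepFun_infinitePi (P := fun _ : ℕ => (expMeasure 1).prod ν) (X := fun _ x => x)
      fun _ => measurable_id
  have hI := hind.indepFun_finset (Finset.range n) {n} (by simp) fun i => measurable_pi_apply i
  have hI' : IndepFun past (fun s => s n) (pointLaw ν) :=
    hI.comp (φ := ext) (ψ := fun p : ({n} : Finset ℕ) → ℝ × S => p ⟨n, by simp⟩) hext
      (measurable_pi_apply _)
  have hmap := (indepFun_iff_map_prod_eq_prod_map_map hpast.aemeasurable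
    (measurable_pi_apply n).aemeasurable).1 hI'
  have hev : (pointLaw ν).map (fun s => s n) = (expMeasure 1).prod ν :=
    Measure.infinitePi_map_eval (fun _ : ℕ => (expMeasure 1).prod ν) n
  have hin : Measurable fun s => ∫⁻ y, Φ s y ∂(expMeasure 1).prod ν :=
    hΦ.lintegral_prod_right'
  calc ∫⁻ s, Φ s (s n) ∂pointLaw ν
      = ∫⁻ s, Function.uncurry Φ (past s, s n) ∂pointLaw ν := by
        simp only [Function.uncurry_apply_pair, ← hpe]
    _ = ∫⁻ p, Function.uncurry Φ p ∂(pointLaw ν).map fun s => (past s, s n) :=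
        (lintegral_map hΦ (by fun_prop)).symm
    _ = ∫⁻ s, ∫⁻ y, Φ s y ∂(expMeasure 1).prod ν ∂(pointLaw ν).map past := by
        rw [hmap, hev, lintegral_prod _ hΦ.aemeasurable]; rfl
    _ = ∫⁻ s, ∫⁻ y, Φ s y ∂(expMeasure 1).prod ν ∂pointLaw ν := by
        rw [lintegral_map hin hpast]
        simp only [← hpe]

end PointLaw

/-! ### Void probabilities of a marked Poisson process. -/

/-- Distribution functions of non-negative integrable random variables: the truncated means
`A t = ∫₀ᵗ ℙ (f > s) ds` increase from `0` to the mean, and solve the integral equation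
`∫₀^∞ e⁻ˣ ℙ (f ≤ t + x) e^{A (t + x)} dx = e^{A t}`. -/
lemma exists_compensator {S : Type*} [MeasurableSpace S] (ν : Measure S) [IsProbabilityMeasure ν]
    {f : S → ℝ} (hf : Measurable f) (hf0 : ∀ w, 0 ≤ f w) (hfi : Integrable f ν) :
    ∃ A : ℝ → ℝ, Continuous A ∧ A 0 = 0 ∧ (∀ t, 0 ≤ t → A t ≤ ∫ w, f w ∂ν) ∧
      Tendsto A atTop (𝓝 (∫ w, f w ∂ν)) ∧
      ∀ t, 0 ≤ t →
        ∫⁻ x, ν {w | f w ≤ t + x} * ENNReal.ofReal (Real.exp (A (t + x))) ∂expMeasure 1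
          = ENNReal.ofReal (Real.exp (A t)) := by
  have hprob : IsProbabilityMeasure (ν.map f) :=
    Measure.isProbabilityMeasure_map hf.aemeasurable
  let F : ℝ → ℝ := fun t => cdf (ν.map f) t
  have hFν : ∀ t, ENNReal.ofReal (F t) = ν {w | f w ≤ t} := fun t => by
    simp only [F]; rw [ofReal_cdf, Measure.map_apply hf measurableSet_Iic]; rfl
  have hF0 : ∀ t, 0 ≤ F t := fun t => cdf_nonneg _ t
  have hF1 : ∀ t, F t ≤ 1 := fun t => cdf_le_one _ t
  have hFm : Monotone F := fun a b h => monotone_cdf _ h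
  have hFr : ∀ t, ContinuousWithinAt F (Ioi t) t := fun t =>
    ((cdf (ν.map f)).right_continuous t).mono Ioi_subset_Ici_self
  clear_value F
  set G : ℝ → ℝ := fun t => 1 - F t with hG
  have hGν : ∀ t, ν.real {w | t < f w} = G t := fun t => by
    have h : {w | t < f w} = {w | f w ≤ t}ᶜ := by ext w; simp
    rw [h, probReal_compl_eq_one_sub (measurableSet_le hf measurable_const), measureReal_def,
      ← hFν, ENNReal.toReal_ofReal (hF0 t)]
  have hG0 : ∀ t, 0 ≤ G t := fun t => sub_nonneg.2 (hF1 t)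
  have hGa : Antitone G := fun a b h => sub_le_sub_left (hFm h) 1
  have hGi : ∀ a b, IntervalIntegrable G volume a b := fun a b => hGa.intervalIntegrable
  have hc : ∫ w, f w ∂ν = ∫ t in Ioi 0, G t := by
    rw [hfi.integral_eq_integral_meas_lt (ae_of_all _ hf0)]
    simp only [hGν]
  have hGint : IntegrableOn G (Ioi 0) := by
    have h := lintegral_eq_lintegral_meas_lt ν (ae_of_all _ hf0) hf.aemeasurable
    refine ⟨hGa.measurable.aestronglyMeasurable, ?_⟩
    rw [hasFiniteIntegral_iff_ofReal (ae_of_all _ hG0)]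
    refine lt_of_eq_of_lt ?_ (Integrable.lintegral_lt_top hfi)
    rw [h]
    refine lintegral_congr fun t => ?_
    rw [← hGν, ofReal_measureReal]
  set c := ∫ w, f w ∂ν
  set A : ℝ → ℝ := fun t => ∫ s in (0 : ℝ)..t, G s with hA
  have hAc : Continuous A := intervalIntegral.continuous_primitive hGi 0
  have hAlim : Tendsto A atTop (𝓝 c) := by
    rw [hc]; exact intervalIntegral_tendsto_integral_Ioi 0 hGint tendsto_id
  have hAm : Monotone A := fun a b h => by
    rw [← sub_nonneg, hA]
    simp only
    rw [intervalIntegral.integral_interval_sub_left (hGi _ _) (hGi _ _)]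
    exact intervalIntegral.integral_nonneg h fun x _ => hG0 x
  have hAle : ∀ t, A t ≤ c := fun t => hAm.ge_of_tendsto hAlim t
  -- `F` may jump and is only right-continuous; right derivatives suffice for the fundamental
  -- theorem of calculus used below.
  have hAd : ∀ t, HasDerivWithinAt A (G t) (Ioi t) t := fun t => by
    refine HasDerivWithinAt.mono (t := Ici t) ?_ Ioi_subset_Ici_self
    refine intervalIntegral.integral_hasDerivWithinAt_right (hGi _ _)
      (s := Ici t) (t := Ioi t) hGa.measurable.stronglyMeasurable.stronglyMeasurableAtFilter ?_
    exact continuousWithinAt_const.sub (hFr t)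
  refine ⟨A, hAc, by simp [hA], fun t _ => hAle t, hAlim, fun t ht => ?_⟩
  set u : ℝ → ℝ := fun x => Real.exp (-x) * (F (t + x) * Real.exp (A (t + x))) with hu
  have hum : Measurable u := by
    have h1 : Measurable fun x => F (t + x) := hFm.measurable.comp (measurable_const_add t)
    have h2 : Measurable fun x => A (t + x) := hAc.measurable.comp (measurable_const_add t)
    exact (Real.measurable_exp.comp measurable_neg).mul (h1.mul (Real.measurable_exp.comp h2))
  have hu0 : ∀ x, 0 ≤ u x := fun x =>
    mul_nonneg (Real.exp_nonneg _) (mul_nonneg (hF0 _) (Real.exp_nonneg _))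
  have hui : IntegrableOn u (Ioi 0) := by
    have hb : IntegrableOn (fun x => Real.exp (-x) * Real.exp c) (Ioi 0) :=
      (integrableOn_exp_neg_Ioi 0).mul_const _
    refine hb.mono' hum.aestronglyMeasurable (ae_of_all _ fun x => ?_)
    rw [Real.norm_of_nonneg (hu0 x)]
    refine mul_le_mul_of_nonneg_left ?_ (Real.exp_nonneg _)
    calc F (t + x) * Real.exp (A (t + x)) ≤ 1 * Real.exp c :=
          mul_le_mul (hF1 _) (Real.exp_le_exp.2 (hAle _)) (Real.exp_nonneg _) zero_le_one
      _ = Real.exp c := one_mul _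
  -- Since A' = 1 - F, the integrand e^{-x} F e^{A} equals e^{-x} (1 - A') e^{A}, which has an
  -- explicit primitive.
  have hder : ∀ x, HasDerivWithinAt (fun x => -Real.exp (A (t + x) - x)) (u x) (Ioi x) x := by
    intro x
    have hin : HasDerivWithinAt (fun x => t + x) 1 (Ioi x) x :=
      ((hasDerivAt_id x).const_add t).hasDerivWithinAt
    have h1 : HasDerivWithinAt (fun x => A (t + x)) (G (t + x)) (Ioi x) x := by
      simpa [Function.comp_def] using (hAd (t + x)).scomp x hin
        (fun y hy => by simpa using hy)
    have h2 := ((h1.sub (hasDerivAt_id x).hasDerivWithinAt).exp).neg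
    refine h2.congr_deriv ?_
    simp only [hu, hG, id, Pi.sub_apply]
    rw [sub_eq_add_neg (A (t + x)), Real.exp_add]
    ring
  have hint : ∀ b, 0 ≤ b → ∫ x in (0 : ℝ)..b, u x
      = Real.exp (A t) - Real.exp (A (t + b) - b) := by
    intro b hb
    rw [intervalIntegral.integral_eq_sub_of_hasDeriv_right (f := fun x => -Real.exp (A (t + x) - x))
      (by fun_prop) (fun x _ => hder x)
      ((intervalIntegrable_iff_integrableOn_Ioc_of_le hb).2 (hui.mono_set Ioc_subset_Ioi_self))]
    simp only [add_zero, sub_zero]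
    ring
  have hlim : Tendsto (fun b => Real.exp (A t) - Real.exp (A (t + b) - b)) atTop
      (𝓝 (Real.exp (A t) - 0)) := by
    refine tendsto_const_nhds.sub (squeeze_zero (fun b => Real.exp_nonneg _)
      (g := fun b => Real.exp (c - b)) (fun b => Real.exp_le_exp.2 (by linarith [hAle (t + b)])) ?_)
    exact Real.tendsto_exp_atBot.comp (tendsto_atBot_add_const_left _ c tendsto_neg_atTop_atBot)
  have hval : ∫ x in Ioi 0, u x = Real.exp (A t) := by
    refine tendsto_nhds_unique (intervalIntegral_tendsto_integral_Ioi 0 hui tendsto_id) ?_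
    rw [← sub_zero (Real.exp (A t))]
    refine hlim.congr' ?_
    filter_upwards [eventually_ge_atTop 0] with b hb using (hint b hb).symm
  have hmeas : Measurable fun x => ν {w | f w ≤ t + x} * ENNReal.ofReal (Real.exp (A (t + x))) := by
    simp only [← hFν]
    have h1 : Measurable fun x => F (t + x) := hFm.measurable.comp (measurable_const_add t)
    have h2 : Measurable fun x => A (t + x) := hAc.measurable.comp (measurable_const_add t)
    exact h1.ennreal_ofReal.mul (Real.measurable_exp.comp h2).ennreal_ofReal
  rw [lintegral_expMeasure hmeas, ← hval,
    ofReal_integral_eq_lintegral_ofReal hui (ae_of_all _ hu0)]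
  refine lintegral_congr fun x => ?_
  rw [hu, ENNReal.ofReal_mul (Real.exp_nonneg _), ENNReal.ofReal_mul (hF0 _), hFν]

section

variable {S : Type*} [MeasurableSpace S] (ν : Measure S) [IsProbabilityMeasure ν]

@[fun_prop]
lemma measurable_arrivalTime (n : ℕ) :
    Measurable fun s : ℕ → ℝ × S => arrivalTime (fun j => (s j).1) n := by
  unfold arrivalTime
  exact Finset.measurable_sum _ fun i _ => measurable_fst.comp (measurable_pi_apply i)

lemma arrivalTime_succ (e : ℕ → ℝ) (n : ℕ) :
    arrivalTime e (n + 1) = arrivalTime e n + e n := Finset.sum_range_succ _ _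

lemma arrivalTime_congr {e e' : ℕ → ℝ} {n : ℕ} (h : ∀ i < n, e i = e' i) :
    arrivalTime e n = arrivalTime e' n :=
  Finset.sum_congr rfl fun i hi => h i (Finset.mem_range.1 hi)

lemma arrivalTime_nonneg {e : ℕ → ℝ} (he : ∀ j, 0 < e j) (n : ℕ) : 0 ≤ arrivalTime e n :=
  Finset.sum_nonneg fun i _ => (he i).le

lemma arrivalTime_succ_pos {e : ℕ → ℝ} (he : ∀ j, 0 < e j) (n : ℕ) :
    0 < arrivalTime e (n + 1) := by
  rw [arrivalTime_succ]; exact add_pos_of_nonneg_of_pos (arrivalTime_nonneg he n) (he n)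

/-- The probability that no point `(Γ, w)` of a marked unit rate Poisson process satisfies
`Γ < f w`. -/
lemma pointLaw_void_of_integrable {f : S → ℝ} (hf : Measurable f) (hf0 : ∀ w, 0 ≤ f w)
    (hfi : Integrable f ν) :
    pointLaw ν {s | ∀ i, f (s i).2 ≤ arrivalTime (fun j => (s j).1) (i + 1)}
      = ENNReal.ofReal (Real.exp (-∫ w, f w ∂ν)) := by
  obtain ⟨A, hAc, hA0, hAle, hAlim, hAeq⟩ := exists_compensator ν hf hf0 hfi
  set c := ∫ w, f w ∂ν
  let Γ : ℕ → (ℕ → ℝ × S) → ℝ := fun n s => arrivalTime (fun j => (s j).1) n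
  have hΓm : ∀ n, Measurable (Γ n) := measurable_arrivalTime
  have hAm : Measurable A := hAc.measurable
  let ok : ℕ → Set (ℕ → ℝ × S) := fun n => {s | ∀ i < n, f (s i).2 ≤ Γ (i + 1) s}
  have hpt : ∀ i, MeasurableSet {s : ℕ → ℝ × S | f (s i).2 ≤ Γ (i + 1) s} := fun i =>
    measurableSet_le (by fun_prop) (hΓm _)
  have hok : ∀ n, MeasurableSet (ok n) := fun n => by
    have h : ok n = ⋂ i, ⋂ _ : i < n, {s : ℕ → ℝ × S | f (s i).2 ≤ Γ (i + 1) s} := by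
      ext s; simp [ok]
    rw [h]
    exact MeasurableSet.iInter fun i => MeasurableSet.iInter fun _ => hpt i
  -- A martingale: the integral equation for `A` says exactly that averaging `M (n + 1)` over the
  -- next point returns `M n`. Its mean is 1 because A(0) = 0, and its limit is the indicator of
  -- `good` times e^c, so P(good) = e^{-c}.
  let M : ℕ → (ℕ → ℝ × S) → ℝ≥0∞ := fun n s =>
    (ok n).indicator 1 s * ENNReal.ofReal (Real.exp (A (Γ n s)))
  have hMm : ∀ n, Measurable (M n) := fun n =>
    (measurable_one.indicator (hok n)).mul
      (Real.measurable_exp.comp (hAm.comp (hΓm n))).ennreal_ofReal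
  have hM1 : ∀ n, ∫⁻ s, M n s ∂pointLaw ν = 1 := by
    intro n
    induction n with
    | zero => simp [M, ok, Γ, arrivalTime, hA0]
    | succ n ih =>
      let Φ : (ℕ → ℝ × S) → ℝ × S → ℝ≥0∞ := fun s y =>
        (ok n).indicator 1 s * ({p : ℝ × S | f p.2 ≤ p.1}.indicator 1 (Γ n s + y.1, y.2) *
          ENNReal.ofReal (Real.exp (A (Γ n s + y.1))))
      have hset : MeasurableSet {p : ℝ × S | f p.2 ≤ p.1} :=
        measurableSet_le (by fun_prop) measurable_fst
      have hΦ : Measurable (Function.uncurry Φ) := by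
        have hΓ' : Measurable fun p : (ℕ → ℝ × S) × (ℝ × S) => Γ n p.1 + p.2.1 :=
          ((hΓm n).comp measurable_fst).add (by fun_prop)
        exact ((measurable_one.indicator (hok n)).comp measurable_fst).mul
          (((measurable_one.indicator hset).comp (hΓ'.prodMk (by fun_prop))).mul
            (Real.measurable_exp.comp (hAm.comp hΓ')).ennreal_ofReal)
      have hdep : ∀ s s' y, (∀ i < n, s i = s' i) → Φ s y = Φ s' y := by
        intro s s' y h
        have hΓe : ∀ k ≤ n, Γ k s = Γ k s' := fun k hk =>
          arrivalTime_congr fun i hi => by rw [h i (hi.trans_le hk)]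
        have hoke : s ∈ ok n ↔ s' ∈ ok n := by
          refine forall₂_congr fun i hi => ?_
          rw [h i hi, hΓe (i + 1) hi]
        simp only [Φ, hΓe n le_rfl]
        by_cases hs : s ∈ ok n
        · rw [indicator_of_mem hs, indicator_of_mem (hoke.1 hs)]; rfl
        · rw [indicator_of_notMem hs, indicator_of_notMem (fun h' => hs (hoke.2 h'))]
      have hMΦ : ∀ s, M (n + 1) s = Φ s (s n) := by
        intro s
        have hΓs : Γ (n + 1) s = Γ n s + (s n).1 := arrivalTime_succ _ _
        have hoks : s ∈ ok (n + 1) ↔ s ∈ ok n ∧ f (s n).2 ≤ Γ n s + (s n).1 := by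
          rw [← hΓs]
          exact Nat.forall_lt_succ_right
        simp only [M, Φ, hΓs, ← mul_assoc]
        congr 1
        by_cases h1 : s ∈ ok n <;> by_cases h2 : f (s n).2 ≤ Γ n s + (s n).1 <;>
          simp [indicator, hoks, h1, h2]
      have hinner : ∀ s, 0 ≤ Γ n s →
          ∫⁻ y, Φ s y ∂(expMeasure 1).prod ν = M n s := by
        intro s hs
        have hm : Measurable fun y : ℝ × S =>
            {p : ℝ × S | f p.2 ≤ p.1}.indicator (1 : ℝ × S → ℝ≥0∞) (Γ n s + y.1, y.2) *
              ENNReal.ofReal (Real.exp (A (Γ n s + y.1))) :=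
          ((measurable_one.indicator hset).comp (by fun_prop)).mul
            (Real.measurable_exp.comp (hAm.comp (by fun_prop))).ennreal_ofReal
        simp only [Φ, M]
        rw [lintegral_const_mul _ hm, lintegral_prod _ hm.aemeasurable, ← hAeq _ hs]
        congr 1
        refine lintegral_congr fun x => ?_
        have hm2 : Measurable fun w : S =>
            {p : ℝ × S | f p.2 ≤ p.1}.indicator (1 : ℝ × S → ℝ≥0∞) (Γ n s + x, w) :=
          (measurable_one.indicator hset).comp (by fun_prop)
        dsimp only
        rw [lintegral_mul_const _ hm2]
        congr 1
        exact lintegral_indicator_one (s := {w | f w ≤ Γ n s + x})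
          (measurableSet_le hf measurable_const)
      simp only [hMΦ]
      rw [lintegral_pointLaw_step ν n hΦ hdep, ← ih]
      refine lintegral_congr_ae ?_
      filter_upwards [ae_pointLaw_pos ν] with s hs
      exact hinner s (arrivalTime_nonneg hs n)
  set good : Set (ℕ → ℝ × S) := {s | ∀ i, f (s i).2 ≤ Γ (i + 1) s} with hgood
  have hgm : MeasurableSet good := by
    have h : good = ⋂ i, {s : ℕ → ℝ × S | f (s i).2 ≤ Γ (i + 1) s} := by
      ext s; simp [good]
    rw [h]
    exact MeasurableSet.iInter hpt
  have hlim : Tendsto (fun n => ∫⁻ s, M n s ∂pointLaw ν) atTop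
      (𝓝 (∫⁻ s, good.indicator 1 s * ENNReal.ofReal (Real.exp c) ∂pointLaw ν)) := by
    refine tendsto_lintegral_of_dominated_convergence (fun _ => ENNReal.ofReal (Real.exp c))
      hMm (fun n => ?_) (by simp) ?_
    · filter_upwards [ae_pointLaw_pos ν] with s hs
      calc M n s ≤ 1 * ENNReal.ofReal (Real.exp c) := by
            refine mul_le_mul' ?_ (ENNReal.ofReal_le_ofReal (Real.exp_le_exp.2
              (hAle _ (arrivalTime_nonneg hs n))))
            exact indicator_le_self' (fun _ _ => zero_le) s
        _ = ENNReal.ofReal (Real.exp c) := one_mul _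
    · filter_upwards [ae_tendsto_arrivalTime ν] with s hs
      by_cases h : s ∈ good
      · have hn : ∀ n, s ∈ ok n := fun n i _ => h i
        simp only [M, indicator_of_mem h, indicator_of_mem (hn _), Pi.one_apply, one_mul]
        exact ENNReal.tendsto_ofReal ((Real.continuous_exp.tendsto c).comp (hAlim.comp hs))
      · obtain ⟨i, hi⟩ := not_forall.1 h
        rw [indicator_of_notMem h, zero_mul]
        refine tendsto_const_nhds.congr' ?_
        filter_upwards [eventually_gt_atTop i] with n hn
        have : s ∉ ok n := fun h' => hi (h' i hn)
        simp only [M, indicator_of_notMem this, zero_mul]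
  simp only [hM1] at hlim
  have h1 := tendsto_nhds_unique tendsto_const_nhds hlim
  rw [lintegral_mul_const _ (measurable_one.indicator hgm), lintegral_indicator_one hgm] at h1
  have hpos : 0 < Real.exp c := Real.exp_pos c
  rw [Real.exp_neg, ENNReal.ofReal_inv_of_pos hpos]
  exact ENNReal.eq_inv_of_mul_eq_one_left h1.symm

/-- The probability that no point `(Γ, w)` of a marked unit rate Poisson process satisfies
`Γ < g w` is `exp (-∫ g)`. -/
lemma pointLaw_void {g : S → ℝ≥0∞} (hg : Measurable g) :
    pointLaw ν {s | ∀ i, g (s i).2 ≤ ENNReal.ofReal (arrivalTime (fun j => (s j).1) (i + 1))}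
      = if ∫⁻ w, g w ∂ν = ∞ then 0
        else ENNReal.ofReal (Real.exp (-(∫⁻ w, g w ∂ν).toReal)) := by
  have hfin : ∀ g : S → ℝ≥0∞, Measurable g → ∫⁻ w, g w ∂ν ≠ ∞ →
      pointLaw ν {s | ∀ i, g (s i).2 ≤ ENNReal.ofReal (arrivalTime (fun j => (s j).1) (i + 1))}
        = ENNReal.ofReal (Real.exp (-(∫⁻ w, g w ∂ν).toReal)) := by
    intro g hg hgi
    have hlt : ∀ᵐ w ∂ν, g w < ∞ := ae_lt_top hg hgi
    rw [← integral_toReal hg.aemeasurable hlt, ← pointLaw_void_of_integrable ν hg.ennreal_toReal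
      (fun _ => ENNReal.toReal_nonneg) (integrable_toReal_of_lintegral_ne_top hg.aemeasurable hgi)]
    refine measure_congr ?_
    filter_upwards [ae_pointLaw_mark ν hlt, ae_pointLaw_pos ν] with s hs hpos
    refine propext (forall_congr' fun i => ?_)
    exact ENNReal.le_ofReal_iff_toReal_le (hs i).ne (arrivalTime_nonneg hpos _)
  split_ifs with h
  · have hle : ∀ n : ℕ, pointLaw ν {s | ∀ i, g (s i).2
        ≤ ENNReal.ofReal (arrivalTime (fun j => (s j).1) (i + 1))}
          ≤ ENNReal.ofReal (Real.exp (-(n : ℝ))) := by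
      intro n
      -- Truncating `g` only enlarges the event, and some truncation has finite mean exceeding `n`,
      -- which bounds the probability by e^{-n}.
      have hsup : ⨆ m : ℕ, ∫⁻ w, min (g w) m ∂ν = ∞ := by
        rw [← lintegral_iSup (fun m => hg.min measurable_const)
          (fun a b hab w => min_le_min_left _ (by exact_mod_cast hab)), ← h]
        refine lintegral_congr fun w => ?_
        rw [← inf_iSup_eq, ENNReal.iSup_natCast]
        simp
      obtain ⟨m, hm⟩ := lt_iSup_iff.1 (hsup ▸ ENNReal.natCast_lt_top n)
      have hne : ∫⁻ w, min (g w) m ∂ν ≠ ∞ := by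
        refine ne_top_of_le_ne_top (b := ∫⁻ _, (m : ℝ≥0∞) ∂ν) (by simp) ?_
        exact lintegral_mono fun w => min_le_right _ _
      calc pointLaw ν {s | ∀ i, g (s i).2
            ≤ ENNReal.ofReal (arrivalTime (fun j => (s j).1) (i + 1))}
          ≤ pointLaw ν {s | ∀ i, min (g (s i).2) m
            ≤ ENNReal.ofReal (arrivalTime (fun j => (s j).1) (i + 1))} :=
            measure_mono fun s hs i => (min_le_left _ _).trans (hs i)
        _ = _ := hfin _ (hg.min measurable_const) hne
        _ ≤ _ := by
            refine ENNReal.ofReal_le_ofReal (Real.exp_le_exp.2 (neg_le_neg ?_))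
            simpa using ENNReal.toReal_mono hne hm.le
    refine le_antisymm (ge_of_tendsto' (x := atTop) ?_ hle) zero_le
    rw [← ENNReal.ofReal_zero]
    exact ENNReal.tendsto_ofReal (Real.tendsto_exp_neg_atTop_nhds_zero.comp
      tendsto_natCast_atTop_atTop)
  · exact hfin g hg h

end

/-! ### Pathwise analysis of threshold stopping. -/

section Path

variable {K : Type*} [TopologicalSpace K] {e : ℕ → ℝ} {w : ℕ → C(K, ℝ≥0)} {τ : ℝ≥0∞}

lemma arrivalTime_mono (he : ∀ j, 0 < e j) : Monotone (arrivalTime e) :=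
  monotone_nat_of_le_succ fun n => by
    rw [arrivalTime_succ]; exact le_add_of_nonneg_right (he n).le

lemma partialMax_mono (e : ℕ → ℝ) (w : ℕ → C(K, ℝ≥0)) {m n : ℕ} (h : m ≤ n) (x : K) :
    partialMax e w m x ≤ partialMax e w n x :=
  biSup_mono fun _ hi => Finset.range_mono h hi

lemma partialMax_le_fullMax (e : ℕ → ℝ) (w : ℕ → C(K, ℝ≥0)) (n : ℕ) (x : K) :
    partialMax e w n x ≤ fullMax e w x :=
  iSup₂_le fun i _ => le_iSup (fun i => contribution e w i x) i

/-- The points after the `n`-th one contribute at most `τ / Γ_{n+1}`. -/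
lemma fullMax_le (he : ∀ j, 0 < e j) (hw : ∀ j x, (w j x : ℝ≥0∞) ≤ τ) (n : ℕ) (x : K) :
    fullMax e w x ≤ max (partialMax e w n x) (τ / ENNReal.ofReal (arrivalTime e (n + 1))) := by
  refine iSup_le fun i => ?_
  rcases lt_or_ge i n with h | h
  · exact le_max_of_le_left
      (le_iSup₂ (f := fun i (_ : i ∈ Finset.range n) => contribution e w i x) i
        (Finset.mem_range.2 h))
  · exact le_max_of_le_right (ENNReal.div_le_div (hw i x)
      (ENNReal.ofReal_le_ofReal (arrivalTime_mono he (by omega))))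

variable {ι : Type*}

/-- Later points raise the maximum at most to τ/Γ_{n+1}, and the decreasing map τ/· turns a maximum
with τ/Γ_{n+1} into a minimum with Γ_{n+1}. Below that level the first `n` points thus already
determine τ / inf. -/
lemma min_div_iInf_fullMax (hτ0 : τ ≠ 0) (hτ : τ ≠ ∞) (he : ∀ j, 0 < e j)
    (hw : ∀ j x, (w j x : ℝ≥0∞) ≤ τ) (q : ι → K) (n : ℕ) :
    min (τ / ⨅ i, fullMax e w (q i)) (ENNReal.ofReal (arrivalTime e (n + 1)))
      = min (τ / ⨅ i, partialMax e w n (q i)) (ENNReal.ofReal (arrivalTime e (n + 1))) := by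
  set γ := ENNReal.ofReal (arrivalTime e (n + 1)) with hγ
  have hγ0 : γ ≠ 0 := by simpa [hγ] using arrivalTime_succ_pos he n
  have hγt : γ ≠ ∞ := ENNReal.ofReal_ne_top
  have hanti : Antitone fun a : ℝ≥0∞ => τ / a := fun a b h => ENNReal.div_le_div_left h τ
  refine le_antisymm (min_le_min_right _ (hanti (iInf_mono fun i => partialMax_le_fullMax ..)))
    (le_min ?_ (min_le_right _ _))
  have h1 : ⨅ i, fullMax e w (q i) ≤ max (⨅ i, partialMax e w n (q i)) (τ / γ) := by
    rw [iInf_sup_eq]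
    exact iInf_mono fun i => fullMax_le he hw n (q i)
  have h2 : τ / (τ / γ) = γ := by
    rw [ENNReal.div_eq_inv_mul, ENNReal.inv_div (Or.inl hγt) (Or.inl hγ0)]
    exact ENNReal.div_mul_cancel hτ0 hτ
  calc min (τ / ⨅ i, partialMax e w n (q i)) γ
      = τ / max (⨅ i, partialMax e w n (q i)) (τ / γ) := by
        rw [hanti.map_max, h2]
    _ ≤ τ / ⨅ i, fullMax e w (q i) := hanti h1

/-- The sum telescopes: by `min_div_iInf_fullMax` the j-th term is min(R, Γ_{j+1}) - Γ_j, truncated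
at 0, so the partial sums are min(R, Γ_n), which tends to R even when R = ∞. -/
lemma tsum_min_eq (hτ0 : τ ≠ 0) (hτ : τ ≠ ∞) (he : ∀ j, 0 < e j)
    (hΓ : Tendsto (arrivalTime e) atTop atTop)
    (hw : ∀ j x, (w j x : ℝ≥0∞) ≤ τ) (q : ι → K) :
    ∑' j, min (τ / (⨅ i, partialMax e w j (q i)) - ENNReal.ofReal (arrivalTime e j))
        (ENNReal.ofReal (e j))
      = τ / ⨅ i, fullMax e w (q i) := by
  set R := τ / ⨅ i, fullMax e w (q i) with hR
  have hsum : ∀ n, ∑ j ∈ Finset.range n,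
      min (τ / (⨅ i, partialMax e w j (q i)) - ENNReal.ofReal (arrivalTime e j))
        (ENNReal.ofReal (e j)) = min R (ENNReal.ofReal (arrivalTime e n)) := by
    intro n
    induction n with
    | zero => simp [arrivalTime]
    | succ n ih =>
      have hΓn : ENNReal.ofReal (arrivalTime e (n + 1))
          = ENNReal.ofReal (arrivalTime e n) + ENNReal.ofReal (e n) := by
        rw [arrivalTime_succ, ENNReal.ofReal_add (arrivalTime_nonneg he n) (he n).le]
      have hmono : Monotone fun a : ℝ≥0∞ => a - ENNReal.ofReal (arrivalTime e n) :=
        fun a b h => tsub_le_tsub_right h _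
      have hstep : min (τ / (⨅ i, partialMax e w n (q i)) - ENNReal.ofReal (arrivalTime e n))
          (ENNReal.ofReal (e n)) = min R (ENNReal.ofReal (arrivalTime e (n + 1)))
            - ENNReal.ofReal (arrivalTime e n) := by
        rw [hR, min_div_iInf_fullMax hτ0 hτ he hw q n]
        have h := hmono.map_min (a := τ / (⨅ i, partialMax e w n (q i)))
          (b := ENNReal.ofReal (arrivalTime e (n + 1)))
        rw [h, hΓn, ENNReal.add_sub_cancel_left ENNReal.ofReal_ne_top]
      have hle : ENNReal.ofReal (arrivalTime e n) ≤ ENNReal.ofReal (arrivalTime e (n + 1)) :=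
        hΓn ▸ le_self_add
      rw [Finset.sum_range_succ, ih, hstep]
      rcases le_total (ENNReal.ofReal (arrivalTime e n)) R with h | h
      · rw [min_eq_right h, add_tsub_cancel_of_le (le_min h hle)]
      · rw [min_eq_left h, min_eq_left (h.trans hle), tsub_eq_zero_of_le h, add_zero]
  refine tendsto_nhds_unique (ENNReal.tendsto_nat_tsum _) ?_
  simp only [hsum]
  have h := (tendsto_const_nhds (x := R)).min (ENNReal.tendsto_ofReal_atTop.comp hΓ)
  simpa using h

/-- `p` holds exactly below its first failure, which is at least 1 by `h0`; if it never fails, both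
sides are ∞. -/
lemma toENNReal_iInf_not {p : ℕ → Prop} [DecidablePred p] (h0 : p 0) (hp : ∀ n, p (n + 1) → p n) :
    ((⨅ (j : ℕ) (_ : 1 ≤ j ∧ ¬ p j), (j : ℕ∞) : ℕ∞) : ℝ≥0∞) = ∑' j, if p j then 1 else 0 := by
  have hanti : ∀ {m n}, m ≤ n → p n → p m := fun {m n} h =>
    Nat.le_induction (P := fun n _ => p n → p m) id (fun n _ ih h' => ih (hp n h')) n h
  by_cases hall : ∀ n, p n
  · simp [hall]
  · push Not at hall
    have hlt : ∀ j, p j ↔ j < Nat.find hall := fun j =>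
      ⟨fun hj => not_le.1 fun h => Nat.find_spec hall (hanti h hj),
        fun hj => not_not.1 (Nat.find_min hall hj)⟩
    set n := Nat.find hall
    have hn : 1 ≤ n := (hlt 0).1 h0
    have hinf : (⨅ (j : ℕ) (_ : 1 ≤ j ∧ ¬ p j), (j : ℕ∞)) = n := by
      refine le_antisymm (iInf₂_le n ⟨hn, by simp [hlt]⟩) (le_iInf₂ fun j hj => ?_)
      have : n ≤ j := not_lt.1 ((hlt j).not.1 hj.2)
      exact_mod_cast this
    rw [hinf, tsum_eq_sum (s := Finset.range n) (fun j hj => by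
      rw [if_neg]; simpa [hlt] using hj)]
    rw [Finset.sum_congr rfl (g := fun _ => 1) (fun j hj => by
      rw [if_pos]; simpa [hlt] using hj)]
    simp

/-- Reduces infima over `K` to countable ones, which are measurable and determined by the law on a
countable product. -/
lemma iInf_comp_denseRange {f : K → ℝ≥0∞} (hf : Continuous f) {q : ι → K} (hq : DenseRange q) :
    ⨅ i, f (q i) = ⨅ x, f x := by
  refine le_antisymm (le_iInf fun x => ?_) (le_iInf fun i => iInf_le f (q i))
  exact hq.induction_on (p := fun x => ⨅ i, f (q i) ≤ f x) x
    (isClosed_le continuous_const hf) fun i => iInf_le (fun i => f (q i)) i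

lemma iSup_comp_denseRange {f : K → ℝ≥0∞} (hf : Continuous f) {q : ι → K} (hq : DenseRange q) :
    ⨆ i, f (q i) = ⨆ x, f x := by
  refine le_antisymm (iSup_le fun i => le_iSup f (q i)) (iSup_le fun x => ?_)
  exact hq.induction_on (p := fun x => f x ≤ ⨆ i, f (q i)) x
    (isClosed_le hf continuous_const) fun i => le_iSup (fun i => f (q i)) i

lemma continuous_partialMax (he : ∀ j, 0 < e j) (w : ℕ → C(K, ℝ≥0)) (n : ℕ) :
    Continuous (partialMax e w n) := by
  have h : partialMax e w n = fun x => (Finset.range n).sup fun i => contribution e w i x := by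
    ext x; rw [Finset.sup_eq_iSup]; rfl
  rw [h]
  refine Continuous.finset_sup_apply fun i _ => ?_
  refine (ENNReal.continuous_div_const _ ?_).comp
    (ENNReal.continuous_coe.comp (w i).continuous)
  simpa using arrivalTime_succ_pos he i

/-- The stopping time counts the `j` with `Γ_{j+1} ≤ τ / inf Z^{(j)}`; the infimum may be taken
over a dense set. -/
lemma stoppingTime_eq_tsum (hτ0 : τ ≠ 0) (hτ : τ ≠ ∞) [Nonempty K] (he : ∀ j, 0 < e j)
    (w : ℕ → C(K, ℝ≥0)) {q : ι → K} (hq : DenseRange q) :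
    (stoppingTime τ e w : ℝ≥0∞) = ∑' j, {x : ℝ | ENNReal.ofReal x
      ≤ τ / (⨅ i, partialMax e w j (q i)) - ENNReal.ofReal (arrivalTime e j)}.indicator 1 (e j) := by
  classical
  let m : ℕ → ℝ≥0∞ := fun j => ⨅ x : K, partialMax e w j x
  have hm : ∀ j, ⨅ i, partialMax e w j (q i) = m j := fun j =>
    iInf_comp_denseRange (continuous_partialMax he w j) hq
  have hmono : ∀ j, m j ≤ m (j + 1) := fun j =>
    iInf_mono fun x => partialMax_mono e w j.le_succ x
  have h := toENNReal_iInf_not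
    (p := fun j => m j ≤ τ / ENNReal.ofReal (arrivalTime e (j + 1)))
    -- With no points the maximum is an empty supremum, hence 0, so the index 0 always counts.
    (by simp [m, partialMax])
    (fun n hn => (hmono n).trans (hn.trans (ENNReal.div_le_div_left
      (ENNReal.ofReal_le_ofReal (arrivalTime_mono he (by omega))) τ)))
  simp only [not_le] at h
  rw [stoppingTime, h]
  refine tsum_congr fun j => ?_
  rw [hm, indicator_apply]
  refine if_congr ?_ rfl rfl
  have hΓn : ENNReal.ofReal (arrivalTime e (j + 1))
      = ENNReal.ofReal (arrivalTime e j) + ENNReal.ofReal (e j) := by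
    rw [arrivalTime_succ, ENNReal.ofReal_add (arrivalTime_nonneg he j) (he j).le]
  have hpos : ENNReal.ofReal (arrivalTime e (j + 1)) ≠ 0 := by
    simpa using arrivalTime_succ_pos he j
  rw [ENNReal.le_div_iff_mul_le (Or.inl hpos) (Or.inl ENNReal.ofReal_ne_top), mul_comm,
    ← ENNReal.le_div_iff_mul_le (Or.inr hτ0) (Or.inr hτ), hΓn, mem_ofPred_eq]
  have he' : ENNReal.ofReal (e j) ≠ 0 := by simpa using he j
  -- Truncated subtraction loses nothing: if τ / m_j ≤ Γ_j, both sides are false because `e j` is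
  -- positive.
  rcases le_total (ENNReal.ofReal (arrivalTime e j)) (τ / m j) with hle | hle
  · rw [add_comm]
    exact ((ENNReal.cancel_of_ne ENNReal.ofReal_ne_top).le_tsub_iff_right hle).symm
  · rw [tsub_eq_zero_of_le hle]
    refine ⟨fun h' => absurd ?_ he', fun h' => absurd (le_zero_iff.1 h') he'⟩
    exact le_zero_iff.1 ((ENNReal.add_le_add_iff_left (ENNReal.ofReal_ne_top)).1
      ((h'.trans hle).trans (add_zero _).ge))

end Path

/-! ### The mean of the stopping time. -/

section Expectation

variable {K : Type*} [TopologicalSpace K]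

@[fun_prop]
lemma measurable_eval_path (x : K) : Measurable fun v : C(K, ℝ≥0) => v x :=
  (ContinuousEvalConst.continuous_eval_const x).measurable

@[fun_prop]
lemma measurable_contribution (i : ℕ) (x : K) :
    Measurable fun s : ℕ → ℝ × C(K, ℝ≥0) =>
      contribution (fun j => (s j).1) (fun j => (s j).2) i x := by
  unfold contribution
  exact ((measurable_eval_path x).comp
    (measurable_snd.comp (measurable_pi_apply i))).coe_nnreal_ennreal.div
    (measurable_arrivalTime _).ennreal_ofReal

@[fun_prop]
lemma measurable_partialMax (n : ℕ) (x : K) :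
    Measurable fun s : ℕ → ℝ × C(K, ℝ≥0) =>
      partialMax (fun j => (s j).1) (fun j => (s j).2) n x := by
  unfold partialMax
  exact Measurable.iSup fun i => Measurable.iSup fun _ => measurable_contribution i x

@[fun_prop]
lemma measurable_fullMax (x : K) :
    Measurable fun s : ℕ → ℝ × C(K, ℝ≥0) =>
      fullMax (fun j => (s j).1) (fun j => (s j).2) x :=
  Measurable.iSup fun i => measurable_contribution i x

/-- An exponential interarrival time compared with a bound that depends on the past. -/
lemma lintegral_interarrival_le {S : Type*} [MeasurableSpace S] (ν : Measure S)
    [IsProbabilityMeasure ν] (n : ℕ) {a : (ℕ → ℝ × S) → ℝ≥0∞} (ha : Measurable a)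
    (hdep : ∀ s s', (∀ i < n, s i = s' i) → a s = a s') :
    ∫⁻ s, {x : ℝ | ENNReal.ofReal x ≤ a s}.indicator 1 (s n).1 ∂pointLaw ν
      = ∫⁻ s, min (a s) (ENNReal.ofReal (s n).1) ∂pointLaw ν := by
  have hset : MeasurableSet {p : (ℕ → ℝ × S) × (ℝ × S) | ENNReal.ofReal p.2.1 ≤ a p.1} :=
    measurableSet_le (by fun_prop) (ha.comp measurable_fst)
  have hm1 : Measurable (Function.uncurry fun (s : ℕ → ℝ × S) (y : ℝ × S) =>
      {x : ℝ | ENNReal.ofReal x ≤ a s}.indicator (1 : ℝ → ℝ≥0∞) y.1) :=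
    measurable_one.indicator hset
  have hm2 : Measurable (Function.uncurry fun (s : ℕ → ℝ × S) (y : ℝ × S) =>
      min (a s) (ENNReal.ofReal y.1)) :=
    (ha.comp measurable_fst).min (by fun_prop)
  rw [lintegral_pointLaw_step ν n hm1 (fun s s' y h => by rw [hdep s s' h]),
    lintegral_pointLaw_step ν n hm2 (fun s s' y h => by rw [hdep s s' h])]
  refine lintegral_congr fun s => ?_
  have hle : MeasurableSet {x : ℝ | ENNReal.ofReal x ≤ a s} :=
    measurableSet_le (by fun_prop) measurable_const
  have hfst : MeasurePreserving Prod.fst ((expMeasure 1).prod ν) (expMeasure 1) :=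
    measurePreserving_fst
  rw [hfst.lintegral_comp (f := {x : ℝ | ENNReal.ofReal x ≤ a s}.indicator 1)
      (measurable_one.indicator hle),
    hfst.lintegral_comp (f := fun x => min (a s) (ENNReal.ofReal x)) (by fun_prop),
    lintegral_indicator_one hle, lintegral_min_expMeasure]

variable [Nonempty K] {ι : Type*} [Countable ι] {q : ι → K}

/-- The mean number of points simulated by threshold stopping, for marks bounded by the
threshold. -/
lemma lintegral_stoppingTime (ν : Measure C(K, ℝ≥0)) [IsProbabilityMeasure ν] {τ : ℝ≥0∞}
    (hτ0 : τ ≠ 0) (hτ : τ ≠ ∞) (hν : ∀ᵐ w ∂ν, ∀ x, (w x : ℝ≥0∞) ≤ τ) (hq : DenseRange q) :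
    AEMeasurable (fun s : ℕ → ℝ × C(K, ℝ≥0) =>
        (stoppingTime τ (fun j => (s j).1) (fun j => (s j).2) : ℝ≥0∞)) (pointLaw ν) ∧
      ∫⁻ s, (stoppingTime τ (fun j => (s j).1) (fun j => (s j).2) : ℝ≥0∞) ∂pointLaw ν
        = ∫⁻ s, τ / ⨅ i, fullMax (fun j => (s j).1) (fun j => (s j).2) (q i) ∂pointLaw ν := by
  let a : ℕ → (ℕ → ℝ × C(K, ℝ≥0)) → ℝ≥0∞ := fun n s =>
    τ / (⨅ i, partialMax (fun j => (s j).1) (fun j => (s j).2) n (q i))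
      - ENNReal.ofReal (arrivalTime (fun j => (s j).1) n)
  have ha : ∀ n, Measurable (a n) := fun n =>
    (measurable_const.div (Measurable.iInf fun i => measurable_partialMax n (q i))).sub
      (measurable_arrivalTime n).ennreal_ofReal
  have hdep : ∀ n s s', (∀ i < n, s i = s' i) → a n s = a n s' := by
    intro n s s' h
    have hΓ : ∀ k ≤ n, arrivalTime (fun j => (s j).1) k = arrivalTime (fun j => (s' j).1) k :=
      fun k hk => arrivalTime_congr fun i hi => by rw [h i (hi.trans_le hk)]
    have hZ : ∀ x, partialMax (fun j => (s j).1) (fun j => (s j).2) n x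
        = partialMax (fun j => (s' j).1) (fun j => (s' j).2) n x := fun x => by
      refine iSup_congr fun i => iSup_congr fun hi => ?_
      have hi' := Finset.mem_range.1 hi
      simp only [contribution, hΓ (i + 1) hi', h i hi']
    simp only [a, hΓ n le_rfl, hZ]
  have hind : ∀ n, Measurable fun s : ℕ → ℝ × C(K, ℝ≥0) =>
      {x : ℝ | ENNReal.ofReal x ≤ a n s}.indicator (1 : ℝ → ℝ≥0∞) (s n).1 := fun n =>
    measurable_one.indicator (s := {s | ENNReal.ofReal (s n).1 ≤ a n s})
      (measurableSet_le (by fun_prop) (ha n))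
  have hmin : ∀ n, Measurable fun s : ℕ → ℝ × C(K, ℝ≥0) =>
      min (a n s) (ENNReal.ofReal (s n).1) := fun n => (ha n).min (by fun_prop)
  have hT : (fun s : ℕ → ℝ × C(K, ℝ≥0) =>
        (stoppingTime τ (fun j => (s j).1) (fun j => (s j).2) : ℝ≥0∞))
      =ᵐ[pointLaw ν] fun s => ∑' n,
        {x : ℝ | ENNReal.ofReal x ≤ a n s}.indicator (1 : ℝ → ℝ≥0∞) (s n).1 := by
    filter_upwards [ae_pointLaw_pos ν] with s hs
    exact stoppingTime_eq_tsum hτ0 hτ hs _ hq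
  refine ⟨⟨_, Measurable.tsum hind, hT⟩, ?_⟩
  rw [lintegral_congr_ae hT, lintegral_tsum fun n => (hind n).aemeasurable]
  -- The indicators, whose sum is T, become the minima, whose sum telescopes on each path.
  simp only [lintegral_interarrival_le ν _ (ha _) (hdep _)]
  rw [← lintegral_tsum fun n => (hmin n).aemeasurable]
  refine lintegral_congr_ae ?_
  filter_upwards [ae_pointLaw_pos ν, ae_pointLaw_mark ν hν, ae_tendsto_arrivalTime ν]
    with s hs hw hΓ
  exact tsum_min_eq hτ0 hτ hs hΓ hw q

end Expectation

/-! ### The law of the max-stable process. -/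

section Law

/-- A finite measure on `ι → [0, ∞]` is determined by its values on lower orthants. -/
lemma measure_ext_Iic {ι : Type*} [Countable ι] {μ ν : Measure (ι → ℝ≥0∞)} [IsFiniteMeasure μ]
    (h : ∀ z, μ (Iic z) = ν (Iic z)) : μ = ν := by
  classical
  refine ext_of_generate_finite (range Iic) (le_antisymm ?_ ?_) ?_ ?_ ?_
  · refine iSup_le fun i => ?_
    rw [← measurable_iff_comap_le]
    -- Because ∞ is an admissible bound, the half-space {f i ≤ c} is itself a lower orthant, even in
    -- infinitely many coordinates.
    refine measurable_of_Iic (mδ := .generateFrom (range Iic)) fun c => MeasurableSpace.measurableSet_generateFrom ⟨Function.update ⊤ i c, ?_⟩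
    ext f
    simp only [mem_Iic, mem_preimage, Pi.le_def, Function.update_apply]
    refine ⟨fun h => by simpa using h i, fun h j => ?_⟩
    split_ifs with hj
    · exact hj ▸ h
    · exact le_top
  · refine MeasurableSpace.generateFrom_le ?_
    rintro _ ⟨z, rfl⟩
    have h : Iic z = ⋂ i, {f : ι → ℝ≥0∞ | f i ≤ z i} := by ext f; simp [Pi.le_def]
    rw [h]
    exact MeasurableSet.iInter fun i =>
      measurableSet_le (measurable_pi_apply i) measurable_const
  · rintro _ ⟨z, rfl⟩ _ ⟨z', rfl⟩ _
    exact ⟨z ⊓ z', Iic_inter_Iic.symm⟩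
  · rintro _ ⟨z, rfl⟩
    exact h z
  · have := h ⊤
    rwa [Iic_top] at this

variable {K : Type*} [TopologicalSpace K] {ι : Type*}

/-- The maximum of all contributions, restricted to the points `q i`. -/
noncomputable def maxAt (q : ι → K) (s : ℕ → ℝ × C(K, ℝ≥0)) (i : ι) : ℝ≥0∞ :=
  fullMax (fun j => (s j).1) (fun j => (s j).2) (q i)

lemma measurable_maxAt (q : ι → K) : Measurable (maxAt q) :=
  measurable_pi_lambda _ fun i => measurable_fullMax (q i)

/-- The smallest `t` such that `v (q i) ≤ t * z i` for all `i`. -/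
noncomputable def gauge (q : ι → K) (z : ι → ℝ≥0∞) (v : C(K, ℝ≥0)) : ℝ≥0∞ :=
  ⨆ i, (v (q i) : ℝ≥0∞) / z i

/-- Besides measurability, this homogeneity is all that the change of spectral process requires of
`gauge`. -/
lemma gauge_smul (q : ι → K) (z : ι → ℝ≥0∞) (c : ℝ≥0) (v : C(K, ℝ≥0)) :
    gauge q z (c • v) = c * gauge q z v := by
  simp [gauge, ENNReal.mul_iSup, mul_div_assoc]

lemma IsMarkedPoisson.hasLaw_points {Ω : Type*} [MeasurableSpace Ω] {P : Measure Ω}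
    {ν : Measure C(K, ℝ≥0)} [IsProbabilityMeasure ν] {E : ℕ → Ω → ℝ} {W : ℕ → Ω → C(K, ℝ≥0)}
    (h : IsMarkedPoisson P ν E W) :
    HasLaw (fun ω j => (E j ω, W j ω)) (pointLaw ν) P :=
  h.iIndepFun.hasLaw_infinitePi h.hasLaw
    (aemeasurable_pi_iff.2 fun j => (h.hasLaw j).aemeasurable)

variable {Ω₁ : Type*} [MeasurableSpace Ω₁] {P₁ : Measure Ω₁}
  {Ω₀ : Type*} [MeasurableSpace Ω₀] {P₀ : Measure Ω₀}

lemma hasLaw_maxStable {μ : Measure C(K, ℝ≥0)} [IsProbabilityMeasure μ]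
    {E₁ : ℕ → Ω₁ → ℝ} {V : ℕ → Ω₁ → C(K, ℝ≥0)} (hV : IsMarkedPoisson P₁ μ E₁ V)
    {Z : Ω₀ → C(K, ℝ≥0)}
    (hZ : IdentDistrib (fun (ω : Ω₀) (x : K) => (Z ω x : ℝ≥0∞))
      (fun (ω : Ω₁) (x : K) => fullMax (fun j => E₁ j ω) (fun j => V j ω) x) P₀ P₁)
    (q : ι → K) :
    HasLaw (fun ω i => (Z ω (q i) : ℝ≥0∞)) ((pointLaw μ).map (maxAt q)) P₀ := by
  have hu : Measurable fun (f : K → ℝ≥0∞) i => f (q i) :=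
    measurable_pi_lambda _ fun i => measurable_pi_apply (q i)
  have h := hZ.comp hu
  have h1 : HasLaw (maxAt q) ((pointLaw μ).map (maxAt q)) (pointLaw μ) :=
    ⟨(measurable_maxAt q).aemeasurable, rfl⟩
  have h2 := h1.comp hV.hasLaw_points
  exact ⟨h.aemeasurable_fst, h.map_eq.trans h2.map_eq⟩

variable [Countable ι]

lemma measurable_gauge (q : ι → K) (z : ι → ℝ≥0∞) : Measurable (gauge q z) :=
  Measurable.iSup fun i => (measurable_eval_path (q i)).coe_nnreal_ennreal.div measurable_const

/-- As Γ is positive and finite, w/Γ ≤ z is equivalent to w/z ≤ Γ, even where z is 0 or ∞. So the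
maximum stays below `z` iff no point has Γ < `gauge q z w`, a void event. -/
lemma pointLaw_maxAt_le (ν : Measure C(K, ℝ≥0)) [IsProbabilityMeasure ν] (q : ι → K)
    (z : ι → ℝ≥0∞) :
    (pointLaw ν).map (maxAt q) (Iic z)
      = if ∫⁻ w, gauge q z w ∂ν = ∞ then 0
        else ENNReal.ofReal (Real.exp (-(∫⁻ w, gauge q z w ∂ν).toReal)) := by
  have hz : MeasurableSet (Iic z) := by
    have h : Iic z = ⋂ i, {f : ι → ℝ≥0∞ | f i ≤ z i} := by ext f; simp [Pi.le_def]
    rw [h]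
    exact MeasurableSet.iInter fun i =>
      measurableSet_le (measurable_pi_apply i) measurable_const
  rw [← pointLaw_void ν (measurable_gauge q z), Measure.map_apply (measurable_maxAt q) hz]
  refine measure_congr ?_
  filter_upwards [ae_pointLaw_pos ν] with s hs
  refine propext ?_
  have hiff : ∀ i j, contribution (fun j => (s j).1) (fun j => (s j).2) i (q j) ≤ z j ↔
      ((s i).2 (q j) : ℝ≥0∞) / z j
        ≤ ENNReal.ofReal (arrivalTime (fun j => (s j).1) (i + 1)) := by
    intro i j
    have h0 : ENNReal.ofReal (arrivalTime (fun j => (s j).1) (i + 1)) ≠ 0 := by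
      simpa using arrivalTime_succ_pos hs i
    have ht : ENNReal.ofReal (arrivalTime (fun j => (s j).1) (i + 1)) ≠ ∞ :=
      ENNReal.ofReal_ne_top
    rw [contribution, ENNReal.div_le_iff_le_mul (Or.inl h0) (Or.inl ht), mul_comm,
      ← ENNReal.div_le_iff_le_mul (Or.inr ht) (Or.inr h0)]
  calc maxAt q s ≤ z ↔ ∀ j i, contribution (fun j => (s j).1) (fun j => (s j).2) i (q j) ≤ z j :=
        forall_congr' fun j => iSup_le_iff
    _ ↔ ∀ i j, ((s i).2 (q j) : ℝ≥0∞) / z j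
          ≤ ENNReal.ofReal (arrivalTime (fun j => (s j).1) (i + 1)) := by
        rw [forall_comm]; simp only [hiff]
    _ ↔ _ := forall_congr' fun i => iSup_le_iff.symm

/-- The law of the max-stable process is determined by the exponent functionals. -/
lemma map_maxAt_congr {μ ν : Measure C(K, ℝ≥0)} [IsProbabilityMeasure μ] [IsProbabilityMeasure ν]
    (q : ι → K) (h : ∀ z, ∫⁻ w, gauge q z w ∂ν = ∫⁻ w, gauge q z w ∂μ) :
    (pointLaw ν).map (maxAt q) = (pointLaw μ).map (maxAt q) := by
  have := Measure.isProbabilityMeasure_map (μ := pointLaw ν) (measurable_maxAt q).aemeasurable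
  refine measure_ext_Iic fun z => ?_
  rw [pointLaw_maxAt_le, pointLaw_maxAt_le, h z]

variable [Nonempty K]

/-- Threshold stopping with a spectral process that is bounded by the threshold and generates the
same max-stable process. -/
lemma lintegral_stoppingTime_eq {q : ι → K} (hq : DenseRange q)
    {μ ν : Measure C(K, ℝ≥0)} [IsProbabilityMeasure μ] [IsProbabilityMeasure ν]
    {E₁ : ℕ → Ω₁ → ℝ} {V : ℕ → Ω₁ → C(K, ℝ≥0)} (hV : IsMarkedPoisson P₁ μ E₁ V)
    {Z : Ω₀ → C(K, ℝ≥0)}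
    (hZ : IdentDistrib (fun (ω : Ω₀) (x : K) => (Z ω x : ℝ≥0∞))
      (fun (ω : Ω₁) (x : K) => fullMax (fun j => E₁ j ω) (fun j => V j ω) x) P₀ P₁)
    {Ω : Type*} [MeasurableSpace Ω] {P : Measure Ω} {E : ℕ → Ω → ℝ} {W : ℕ → Ω → C(K, ℝ≥0)}
    (hW : IsMarkedPoisson P ν E W) {τ : ℝ≥0∞} (hτ0 : τ ≠ 0) (hτ : τ ≠ ∞)
    (hν : ∀ᵐ w ∂ν, ∀ x, (w x : ℝ≥0∞) ≤ τ)
    (hg : ∀ z, ∫⁻ w, gauge q z w ∂ν = ∫⁻ w, gauge q z w ∂μ) :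
    ∫⁻ ω, (stoppingTime τ (fun j => E j ω) (fun j => W j ω) : ℝ≥0∞) ∂P
      = τ * ∫⁻ ω, (⨅ x : K, (Z ω x : ℝ≥0∞))⁻¹ ∂P₀ := by
  obtain ⟨hTm, hT⟩ := lintegral_stoppingTime ν hτ0 hτ hν hq
  have hF : Measurable fun f : ι → ℝ≥0∞ => τ / ⨅ i, f i :=
    measurable_const.div (Measurable.iInf fun i => measurable_pi_apply i)
  have hinf : ∀ ω, ⨅ x : K, (Z ω x : ℝ≥0∞) = ⨅ i, (Z ω (q i) : ℝ≥0∞) := fun ω =>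
    (iInf_comp_denseRange (ENNReal.continuous_coe.comp (Z ω).continuous) hq).symm
  calc ∫⁻ ω, (stoppingTime τ (fun j => E j ω) (fun j => W j ω) : ℝ≥0∞) ∂P
      = ∫⁻ s, (stoppingTime τ (fun j => (s j).1) (fun j => (s j).2) : ℝ≥0∞) ∂pointLaw ν :=
        hW.hasLaw_points.lintegral_comp hTm
    _ = ∫⁻ s, τ / ⨅ i, maxAt q s i ∂pointLaw ν := hT
    _ = ∫⁻ f, τ / ⨅ i, f i ∂(pointLaw ν).map (maxAt q) :=
        (lintegral_map hF (measurable_maxAt q)).symm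
    _ = ∫⁻ f, τ / ⨅ i, f i ∂(pointLaw μ).map (maxAt q) := by rw [map_maxAt_congr q hg]
    _ = ∫⁻ ω, τ / ⨅ i, (Z ω (q i) : ℝ≥0∞) ∂P₀ :=
        ((hasLaw_maxStable hV hZ q).lintegral_comp hF.aemeasurable).symm
    _ = τ * ∫⁻ ω, (⨅ x : K, (Z ω x : ℝ≥0∞))⁻¹ ∂P₀ := by
        rw [← lintegral_const_mul' _ _ hτ]
        simp only [hinf, div_eq_mul_inv]

end Law

/-! ### The sup- and sum-normalized spectral laws. -/

section Normalized

lemma measurableSet_forall_le {K : Type*} [TopologicalSpace K] (c : ℝ≥0∞) :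
    MeasurableSet {w : C(K, ℝ≥0) | ∀ x, (w x : ℝ≥0∞) ≤ c} := by
  rw [ofPred_forall]
  exact (isClosed_iInter fun x => isClosed_le
    (ENNReal.continuous_coe.comp (ContinuousEvalConst.continuous_eval_const x))
    continuous_const).measurableSet

variable {K : Type*} [MetricSpace K] [CompactSpace K]

lemma coe_supNorm (v : C(K, ℝ≥0)) : (supNorm v : ℝ≥0∞) = ⨆ x, (v x : ℝ≥0∞) :=
  ENNReal.coe_iSup (isCompact_range v.continuous).bddAbove

lemma le_supNorm (v : C(K, ℝ≥0)) (x : K) : v x ≤ supNorm v :=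
  le_ciSup (isCompact_range v.continuous).bddAbove x

lemma measurable_supNorm : Measurable (supNorm : C(K, ℝ≥0) → ℝ≥0) := by
  rcases isEmpty_or_nonempty K with h | h
  · have : (supNorm : C(K, ℝ≥0) → ℝ≥0) = fun _ => 0 := by
      ext v; simp [supNorm]
    rw [this]; exact measurable_const
  have h : Measurable fun v : C(K, ℝ≥0) => (supNorm v : ℝ≥0∞) := by
    have he : (fun v : C(K, ℝ≥0) => (supNorm v : ℝ≥0∞))
        = fun v => ⨆ n, (v (TopologicalSpace.denseSeq K n) : ℝ≥0∞) := by
      ext v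
      rw [coe_supNorm]
      exact (iSup_comp_denseRange (ENNReal.continuous_coe.comp v.continuous)
        (TopologicalSpace.denseRange_denseSeq K)).symm
    rw [he]
    exact Measurable.iSup fun n => (measurable_eval_path _).coe_nnreal_ennreal
  simpa using h.ennreal_toNNReal

lemma measurable_smul_path {f : C(K, ℝ≥0) → ℝ≥0} (hf : Measurable f) :
    Measurable fun v => f v • v :=
  hf.smul measurable_id

variable {μ : Measure C(K, ℝ≥0)}

lemma measurable_supNormalize (c : ℝ≥0) :
    Measurable fun y : C(K, ℝ≥0) => (c / supNorm y) • y :=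
  measurable_smul_path (f := fun y => c / supNorm y) (measurable_supNorm.const_div c)

lemma isProbabilityMeasure_supNormalizedLaw (h0 : supCoeff μ ≠ 0) (h1 : supCoeff μ ≠ ∞) :
    IsProbabilityMeasure (supNormalizedLaw μ) := by
  refine ⟨?_⟩
  rw [supNormalizedLaw, Measure.map_apply (measurable_supNormalize _) MeasurableSet.univ,
    preimage_univ, supTiltedLaw, Measure.smul_apply, withDensity_apply _ MeasurableSet.univ,
    Measure.restrict_univ]
  exact ENNReal.inv_mul_cancel h0 h1

lemma ae_supNormalizedLaw_le (h1 : supCoeff μ ≠ ∞) :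
    ∀ᵐ w ∂supNormalizedLaw μ, ∀ x, (w x : ℝ≥0∞) ≤ supCoeff μ := by
  rw [supNormalizedLaw, ae_map_iff (measurable_supNormalize _).aemeasurable
    (measurableSet_forall_le _)]
  refine ae_of_all _ fun v x => ?_
  have h2 : (supCoeff μ).toNNReal / supNorm v * v x ≤ (supCoeff μ).toNNReal := by
    rw [div_mul_eq_mul_div]
    exact div_le_of_le_mul₀ zero_le zero_le (mul_le_mul_right (le_supNorm v x) _)
  rw [← ENNReal.coe_toNNReal h1]
  exact_mod_cast h2

/-- Homogeneity pulls the factor θ_∞/‖v‖ out of `g`, and the tilting density ‖v‖/θ_∞ cancels it. A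
path with ‖v‖ = 0 is zero, so `g` vanishes there. -/
lemma lintegral_supNormalizedLaw (h0 : supCoeff μ ≠ 0) (h1 : supCoeff μ ≠ ∞)
    {g : C(K, ℝ≥0) → ℝ≥0∞} (hg : Measurable g) (hgs : ∀ (c : ℝ≥0) v, g (c • v) = c * g v) :
    ∫⁻ w, g w ∂supNormalizedLaw μ = ∫⁻ v, g v ∂μ := by
  have hT := measurable_supNormalize (K := K) (supCoeff μ).toNNReal
  have hpt : ∀ v : C(K, ℝ≥0),
      (supNorm v : ℝ≥0∞) * g (((supCoeff μ).toNNReal / supNorm v) • v) = supCoeff μ * g v := by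
    intro v
    rw [hgs, ← mul_assoc, ← ENNReal.coe_mul]
    by_cases hv : supNorm v = 0
    · have hv0 : v = (0 : ℝ≥0) • v := by
        ext x
        have := le_supNorm v x
        simp [hv] at this
        simp [this]
      have : g v = 0 := by rw [hv0, hgs]; simp
      simp [this]
    · rw [mul_div_cancel₀ _ hv, ENNReal.coe_toNNReal h1]
  have hgT : Measurable fun y : C(K, ℝ≥0) => g (((supCoeff μ).toNNReal / supNorm y) • y) :=
    hg.comp hT
  rw [supNormalizedLaw, lintegral_map hg hT, supTiltedLaw, lintegral_smul_measure,
    lintegral_withDensity_eq_lintegral_mul _ measurable_supNorm.coe_nnreal_ennreal hgT]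
  simp only [Pi.mul_apply, hpt]
  rw [lintegral_const_mul _ hg, smul_eq_mul, ← mul_assoc, ENNReal.inv_mul_cancel h0 h1, one_mul]

variable {N : ℕ} {x : Fin N → K}

lemma measurable_sumNormalize :
    Measurable fun y : C(K, ℝ≥0) => ((N : ℝ≥0) / ∑ k, y (x k)) • y :=
  measurable_smul_path (measurable_const.div
    (Finset.measurable_sum _ fun k _ => measurable_eval_path (x k)))

lemma measurable_pointNormalize (a : K) : Measurable fun v : C(K, ℝ≥0) => (v a)⁻¹ • v :=
  measurable_smul_path (measurable_eval_path a).inv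

lemma isProbabilityMeasure_sumNormalizedLaw (hμ : IsSpectralLaw μ) (hN : N ≠ 0) :
    IsProbabilityMeasure (sumNormalizedLaw μ x) := by
  have hp : ∀ a, pointNormalizedLaw μ a univ = 1 := fun a => by
    rw [pointNormalizedLaw, Measure.map_apply (measurable_pointNormalize a) MeasurableSet.univ,
      preimage_univ, withDensity_apply _ MeasurableSet.univ, Measure.restrict_univ,
      hμ.lintegral_eval]
  refine ⟨?_⟩
  rw [sumNormalizedLaw, Measure.map_apply measurable_sumNormalize MeasurableSet.univ,
    preimage_univ, Measure.smul_apply, Measure.finsetSum_apply]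
  simp only [hp, Finset.sum_const, Finset.card_univ, Fintype.card_fin, nsmul_eq_mul, mul_one,
    smul_eq_mul]
  exact ENNReal.inv_mul_cancel (by exact_mod_cast hN) (ENNReal.natCast_ne_top N)

lemma ae_sumNormalizedLaw_le (hx : Function.Surjective x) :
    ∀ᵐ w ∂sumNormalizedLaw μ x, ∀ a, (w a : ℝ≥0∞) ≤ N := by
  rw [sumNormalizedLaw, ae_map_iff measurable_sumNormalize.aemeasurable
    (measurableSet_forall_le _)]
  refine ae_of_all _ fun v a => ?_
  obtain ⟨k, rfl⟩ := hx a
  have h : v (x k) ≤ ∑ j, v (x j) :=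
    Finset.single_le_sum (f := fun j => v (x j)) (fun _ _ => zero_le) (Finset.mem_univ k)
  have h2 : (N : ℝ≥0) / (∑ j, v (x j)) * v (x k) ≤ N := by
    rw [div_mul_eq_mul_div]
    exact div_le_of_le_mul₀ zero_le zero_le (mul_le_mul_right h _)
  exact_mod_cast h2

/-- Where v(x_k) ≠ 0, sum-normalization undoes the scaling by 1/v(x_k), so the k-th component
contributes `g v` with weight N v(x_k) / ∑ v(x_j). The weights add up to N unless all v(x_j) vanish;
then surjectivity gives v = 0, hence g v = 0. -/
lemma lintegral_sumNormalizedLaw (hN : N ≠ 0) (hx : Function.Surjective x)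
    {g : C(K, ℝ≥0) → ℝ≥0∞} (hg : Measurable g) (hgs : ∀ (c : ℝ≥0) v, g (c • v) = c * g v) :
    ∫⁻ w, g w ∂sumNormalizedLaw μ x = ∫⁻ v, g v ∂μ := by
  have hS := measurable_sumNormalize (K := K) (x := x)
  have hgS : Measurable fun y : C(K, ℝ≥0) => g (((N : ℝ≥0) / ∑ k, y (x k)) • y) := hg.comp hS
  have hpt : ∀ (v : C(K, ℝ≥0)) k,
      (v (x k) : ℝ≥0∞) * g (((N : ℝ≥0) / ∑ j, ((v (x k))⁻¹ • v) (x j)) • (v (x k))⁻¹ • v)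
        = ((v (x k) * (N / ∑ j, v (x j)) : ℝ≥0) : ℝ≥0∞) * g v := by
    intro v k
    rw [smul_smul, hgs, ← mul_assoc, ← ENNReal.coe_mul]
    congr 2
    by_cases hk : v (x k) = 0
    · simp [hk]
    · simp only [ContinuousMap.smul_apply, smul_eq_mul, ← Finset.mul_sum]
      field_simp
  have hsum : ∀ v : C(K, ℝ≥0),
      ∑ k, ((v (x k) * (N / ∑ j, v (x j)) : ℝ≥0) : ℝ≥0∞) * g v = N * g v := by
    intro v
    rw [← Finset.sum_mul, ← ENNReal.ofNNReal_finsetSum, ← Finset.sum_mul]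
    by_cases hv : ∑ j, v (x j) = 0
    · have hv0 : v = (0 : ℝ≥0) • v := by
        ext a
        obtain ⟨k, rfl⟩ := hx a
        have := (Finset.sum_eq_zero_iff.1 hv) k (Finset.mem_univ k)
        simp [this]
      have : g v = 0 := by rw [hv0, hgs]; simp
      simp [this]
    · rw [mul_div_cancel₀ _ hv]; simp
  rw [sumNormalizedLaw, lintegral_map hg hS, lintegral_smul_measure, lintegral_finsetSum_measure]
  have hk : ∀ k, ∫⁻ y, g (((N : ℝ≥0) / ∑ j, y (x j)) • y) ∂pointNormalizedLaw μ (x k)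
      = ∫⁻ v, ((v (x k) * (N / ∑ j, v (x j)) : ℝ≥0) : ℝ≥0∞) * g v ∂μ := by
    intro k
    have hP := measurable_pointNormalize (x k)
    have hgP : Measurable fun v : C(K, ℝ≥0) =>
        g (((N : ℝ≥0) / ∑ j, ((v (x k))⁻¹ • v) (x j)) • (v (x k))⁻¹ • v) := hgS.comp hP
    rw [pointNormalizedLaw, lintegral_map hgS hP, lintegral_withDensity_eq_lintegral_mul _
      (measurable_eval_path (x k)).coe_nnreal_ennreal hgP]
    exact lintegral_congr fun v => hpt v k
  simp only [hk]
  rw [← lintegral_finsetSum]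
  · simp only [hsum]
    rw [lintegral_const_mul _ hg, smul_eq_mul, ← mul_assoc,
      ENNReal.inv_mul_cancel (by exact_mod_cast hN) (ENNReal.natCast_ne_top N), one_mul]
  · intro k _
    exact ((measurable_eval_path (x k)).mul (measurable_const.div (Finset.measurable_sum _
      fun k _ => measurable_eval_path (x k)))).coe_nnreal_ennreal.mul hg

lemma supCoeff_ne_zero [Nonempty K] (hμ : IsSpectralLaw μ) : supCoeff μ ≠ 0 := by
  have a : K := Classical.arbitrary K
  have h : 1 ≤ supCoeff μ := by
    rw [← hμ.lintegral_eval a]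
    exact lintegral_mono fun v => ENNReal.coe_le_coe.2 (le_supNorm v a)
  exact (zero_lt_one.trans_le h).ne'

/-- The mean of the supremum is finite, since the max-stable process has bounded paths. -/
lemma supCoeff_ne_top [Nonempty K] [IsProbabilityMeasure μ]
    {Ω₁ : Type*} [MeasurableSpace Ω₁] {P₁ : Measure Ω₁}
    {Ω₀ : Type*} [MeasurableSpace Ω₀] {P₀ : Measure Ω₀} [IsProbabilityMeasure P₀]
    {E₁ : ℕ → Ω₁ → ℝ} {V : ℕ → Ω₁ → C(K, ℝ≥0)} (hV : IsMarkedPoisson P₁ μ E₁ V)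
    {Z : Ω₀ → C(K, ℝ≥0)}
    (hZ : IdentDistrib (fun (ω : Ω₀) (x : K) => (Z ω x : ℝ≥0∞))
      (fun (ω : Ω₁) (x : K) => fullMax (fun j => E₁ j ω) (fun j => V j ω) x) P₀ P₁) :
    supCoeff μ ≠ ∞ := by
  intro htop
  set q := TopologicalSpace.denseSeq K
  have hlaw := hasLaw_maxStable hV hZ q
  -- At a constant level the gauge is a multiple of the sup norm, so θ_∞ = ∞ gives a void
  -- probability of 0. Hence Z would almost surely be unbounded, although its paths are continuous
  -- on a compact space.
  have hzero : ∀ n : ℕ, P₀ {ω | ∀ i, (Z ω (q i) : ℝ≥0∞) ≤ ((n + 1 : ℕ) : ℝ≥0∞)} = 0 := by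
    intro n
    have hg : ∫⁻ w, gauge q (fun _ => ((n + 1 : ℕ) : ℝ≥0∞)) w ∂μ = ∞ := by
      have he : ∀ w : C(K, ℝ≥0), gauge q (fun _ => ((n + 1 : ℕ) : ℝ≥0∞)) w
          = ((n + 1 : ℕ) : ℝ≥0∞)⁻¹ * supNorm w := by
        intro w
        simp only [gauge, div_eq_mul_inv]
        rw [← ENNReal.iSup_mul, mul_comm, coe_supNorm]
        congr 1
        exact iSup_comp_denseRange (ENNReal.continuous_coe.comp w.continuous)
          (TopologicalSpace.denseRange_denseSeq K)
      simp only [he]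
      rw [lintegral_const_mul _ measurable_supNorm.coe_nnreal_ennreal]
      change _ * supCoeff μ = ∞
      rw [htop]
      exact ENNReal.mul_top (ENNReal.inv_ne_zero.2 (ENNReal.natCast_ne_top _))
    have h := pointLaw_maxAt_le μ q fun _ => ((n + 1 : ℕ) : ℝ≥0∞)
    rw [if_pos hg, ← hlaw.map_eq] at h
    exact measure_mono_null (fun ω hω => hω)
      (le_antisymm ((Measure.le_map_apply hlaw.aemeasurable _).trans h.le) zero_le)
  have hae : ∀ᵐ ω ∂P₀, ∀ n : ℕ, ¬ ∀ i, (Z ω (q i) : ℝ≥0∞) ≤ ((n + 1 : ℕ) : ℝ≥0∞) :=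
    ae_all_iff.2 fun n => by rw [ae_iff]; simpa using hzero n
  obtain ⟨ω, hω⟩ := hae.exists
  obtain ⟨n, hn⟩ := exists_nat_ge (supNorm (Z ω))
  refine hω n fun i => ?_
  have h : Z ω (q i) ≤ ((n + 1 : ℕ) : ℝ≥0) :=
    (le_supNorm _ _).trans (hn.trans (by simp))
  exact_mod_cast h

end Normalized

end MaxStable

theorem mainTheorem6 {K : Type*} [MetricSpace K] [CompactSpace K] [Nonempty K]
    -- the law of the spectral process `V` from which `Z` is built
    (μ : Measure C(K, ℝ≥0)) (hμ : MaxStable.IsSpectralLaw μ)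
    {Ω₁ : Type*} [MeasurableSpace Ω₁] (P₁ : Measure Ω₁) [IsProbabilityMeasure P₁]
    (E₁ : ℕ → Ω₁ → ℝ) (V : ℕ → Ω₁ → C(K, ℝ≥0)) (hV : MaxStable.IsMarkedPoisson P₁ μ E₁ V)
    -- the sample-continuous process `Z` with `Z = max_j V_j / Γ_j` in distribution
    {Ω₀ : Type*} [MeasurableSpace Ω₀] (P₀ : Measure Ω₀) [IsProbabilityMeasure P₀]
    (Z : Ω₀ → C(K, ℝ≥0)) (hZm : AEMeasurable Z P₀)
    (hZ : IdentDistrib (fun (ω : Ω₀) (x : K) => (Z ω x : ℝ≥0∞))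
      (fun (ω : Ω₁) (x : K) => MaxStable.fullMax (fun j => E₁ j ω) (fun j => V j ω) x) P₀ P₁)
    -- the sequences simulated in the threshold stopping algorithm
    {Ω : Type*} [MeasurableSpace Ω] (P : Measure Ω) [IsProbabilityMeasure P]
    (E : ℕ → Ω → ℝ) (W : ℕ → Ω → C(K, ℝ≥0)) :
    (MaxStable.IsMarkedPoisson P (MaxStable.supNormalizedLaw μ) E W →
      ∫⁻ ω, (MaxStable.stoppingTime (MaxStable.supCoeff μ)
          (fun j => E j ω) (fun j => W j ω) : ℝ≥0∞) ∂P
        = MaxStable.supCoeff μ * ∫⁻ ω, (⨅ x : K, (Z ω x : ℝ≥0∞))⁻¹ ∂P₀) ∧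
    (∀ (N : ℕ) (x : Fin N → K), Function.Surjective x →
      MaxStable.IsMarkedPoisson P (MaxStable.sumNormalizedLaw μ x) E W →
      ∫⁻ ω, (MaxStable.stoppingTime (N : ℝ≥0∞)
          (fun j => E j ω) (fun j => W j ω) : ℝ≥0∞) ∂P
        = (N : ℝ≥0∞) * ∫⁻ ω, (⨅ x : K, (Z ω x : ℝ≥0∞))⁻¹ ∂P₀) := by
  have hprob := hμ.isProbabilityMeasure
  have hq := TopologicalSpace.denseRange_denseSeq K
  refine ⟨fun hW => ?_, fun N x hx hW => ?_⟩
  · have h0 := MaxStable.supCoeff_ne_zero hμ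
    have h1 := MaxStable.supCoeff_ne_top hV hZ
    have := MaxStable.isProbabilityMeasure_supNormalizedLaw h0 h1
    exact MaxStable.lintegral_stoppingTime_eq hq hV hZ hW h0 h1
      (MaxStable.ae_supNormalizedLaw_le h1) fun z =>
        MaxStable.lintegral_supNormalizedLaw h0 h1 (MaxStable.measurable_gauge _ z)
          (MaxStable.gauge_smul _ z)
  · have hN : N ≠ 0 := by
      rintro rfl
      obtain ⟨k, -⟩ := hx (Classical.arbitrary K)
      exact k.elim0
    have := MaxStable.isProbabilityMeasure_sumNormalizedLaw (x := x) hμ hN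
    exact MaxStable.lintegral_stoppingTime_eq hq hV hZ hW (by exact_mod_cast hN)
      (ENNReal.natCast_ne_top N) (MaxStable.ae_sumNormalizedLaw_le hx) fun z =>
        MaxStable.lintegral_sumNormalizedLaw hN hx (MaxStable.measurable_gauge _ z)
          (MaxStable.gauge_smul _ z)
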